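/- **Setting.** Let $k\ge 1$ and $s\ge 2$ be integers. The convolutional network of depth $n$ with filter size $2k+1$ and stride $s$ has layers $0,1,\dots,n$. Layer $n$ consists of a single output node. If layer $t\geq 1$ has $w$ nodes, numbered $0,\dots,w-1$, then layer $t-1$ has $s(w-1)+2k+1$ nodes, and the children of node $i$ of layer $t$ are the $2k+1$ nodes $si,si+1,\dots,si+2k$ of layer $t-1$. Let $N_n$ be the number of nodes of layer $0$. Given filters $\varphi_1,\dots,\varphi_n:\{\pm1\}^{2k+1}\to\{\pm1\}$, the network induces a Boolean function $f_n:\{\pm1\}^{N_n}\to\{\pm1\}$: the nodes of layer $0$ carry the input bits, every node of layer $t$ carries the value of $\varphi_t$ at the values of its children (in order), and $f_n$ is the value of the output node. If every $\varphi_t$ is the majority function $\mathrm{maj}_{2k+1}$, then $f_n$ is the convolutional iterated $(2k+1)$-majority function with stride $s$. Let $\omega$ be uniform on $\{\pm1\}^{N_n}$ and let $\omega^\varepsilon$ arise from $\omega$ by flipping each coordinate independently with probability $\varepsilon$. Boolean functions $f_n$ are *noise sensitive* if $\mathrm{Cov}(f_n(\omega),f_n(\omega^\varepsilon))\to 0$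 as $n\to\infty$ for every $0<\varepsilon\le 1/2$. Random Boolean functions $f_n$, independent of $(\omega,\omega^\varepsilon)$, are *annealed noise sensitive* if for every $0<\varepsilon\le1/2$ the covariance of $f_n(\omega)$ and $f_n(\omega^\varepsilon)$, taken over $f_n$, $\omega$ and $\omega^\varepsilon$ together, tends to $0$; they are *quenched noise sensitive* if for all $0<\varepsilon\le 1/2$ and $\delta>0$ there is $n_0$ such that for all $n\ge n_0$, with probability at least $1-\delta$, $f_n$ is such that $\mathrm{Cov}_{\omega,\omega^\varepsilon}(f_n(\omega),f_n(\omega^\varepsilon))\le\delta$. **Theorem.** Let $k\ge1$ and $s\ge 2$. 1. The sequence of convolutional iterated $(2k+1)$-majority functions with stride $s$ is noise sensitive. 2. In these networks every node has at most $2k$ ancestors in every layer. 3. Let $\theta_1,\theta_2,\dots$ be independent random vectors in $\mathbb R^{2k+1}$ such that, for every $t$, almost surely $\sum_r\theta_{t,r}x_r\ne0$ for all $x\in\{\pm1\}^{2k+1}$, and let $f_n$ be the random Boolean function induced by the filters $\varphi_t(x)=\mathrm{sign}\left(\sum_r\theta_{t,r}x_r\right)$, $t=1,\dots,n$. If there is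 $c>0$ such that $\mathrm P(\varphi_t=\mathrm{maj}_{2k+1})\ge c$ for all $t$, then $(f_n)$ is annealed and quenched noise sensitive. -/

import Mathlib

open MeasureTheory ProbabilityTheory Filter Topology

noncomputable section

namespace ConvMaj

/-- A bit is a `Bool`; `true` stands for `+1` and `false` for `-1`. -/
def sgn (b : Bool) : ℝ := if b then 1 else -1

/-! ### Noise sensitivity -/

/-- The law on `Bool` that gives mass `p` to `true` and `1 - p` to `false`. -/
def coin (p : ℝ) : Measure Bool :=
  ENNReal.ofReal p • Measure.dirac true + ENNReal.ofReal (1 - p) • Measure.dirac false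

/-- The joint law of `(ω, ω^ε)`: `ω` is uniform on `{±1}^N`, and `ω^ε` is obtained from `ω` by
flipping every coordinate independently with probability `ε`. -/
def noiseLaw (N : ℕ) (ε : ℝ) : Measure ((Fin N → Bool) × (Fin N → Bool)) :=
  ((Measure.pi fun _ : Fin N => coin (1 / 2)).prod (Measure.pi fun _ : Fin N => coin ε)).map
    fun p => (p.1, fun i => xor (p.1 i) (p.2 i))

/-- `Cov(f(ω), f(ω^ε))`. -/
def noiseCov {N : ℕ} (f : (Fin N → Bool) → Bool) (ε : ℝ) : ℝ :=
  covariance (fun p => sgn (f p.1)) (fun p => sgn (f p.2)) (noiseLaw N ε)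

/-- The sequence `f n : {±1}^(N n) → {±1}` is noise sensitive. -/
def NoiseSensitive (N : ℕ → ℕ) (f : ∀ n, (Fin (N n) → Bool) → Bool) : Prop :=
  ∀ ε : ℝ, 0 < ε → ε ≤ 1 / 2 → Tendsto (fun n => noiseCov (f n) ε) atTop (𝓝 0)

/-- The laws `π n` on the Boolean functions on `{±1}^(N n)` are quenched noise sensitive. -/
def QuenchedNoiseSensitive (N : ℕ → ℕ)
    (π : ∀ n, Measure ((Fin (N n) → Bool) → Bool)) : Prop :=
  ∀ ε : ℝ, 0 < ε → ε ≤ 1 / 2 → ∀ δ : ℝ, 0 < δ → ∃ n₀ : ℕ, ∀ n, n₀ ≤ n →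
    1 - δ ≤ (π n).real {f | noiseCov f ε ≤ δ}

/-- The laws `π n` on the Boolean functions on `{±1}^(N n)` are annealed noise sensitive: the
covariance is taken over the random function (independent of the bits) and over `(ω, ω^ε)`. -/
def AnnealedNoiseSensitive (N : ℕ → ℕ)
    (π : ∀ n, Measure ((Fin (N n) → Bool) → Bool)) : Prop :=
  ∀ ε : ℝ, 0 < ε → ε ≤ 1 / 2 →
    Tendsto (fun n => covariance (fun q => sgn (q.1 q.2.1)) (fun q => sgn (q.1 q.2.2))
      ((π n).prod (noiseLaw (N n) ε))) atTop (𝓝 0)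

/-! ### The convolutional graph

Nodes of a layer are numbered from `0`. With filter size `2k+1` and stride `s`, node `i` of a layer
has the `2k+1` children `s*i, s*i+1, …, s*i+2k` in the layer below. -/

/-- The number of nodes in the layer that lies `m` layers below the single output node. -/
def width (k s : ℕ) : ℕ → ℕ
  | 0 => 1
  | m + 1 => s * (width k s m - 1) + (2 * k + 1)

theorem child_lt_width (k s m : ℕ) (i : Fin (width k s m)) (r : Fin (2 * k + 1)) :
    s * (i : ℕ) + (r : ℕ) < width k s (m + 1) := by
  have h : s * (i : ℕ) ≤ s * (width k s m - 1) := Nat.mul_le_mul_left _ (by omega)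
  have hr := r.isLt
  simp only [width]
  omega

/-- The `r`-th child of node `i`. -/
def child (k s m : ℕ) (i : Fin (width k s m)) (r : Fin (2 * k + 1)) : Fin (width k s (m + 1)) :=
  ⟨s * (i : ℕ) + (r : ℕ), child_lt_width k s m i r⟩

/-- `IsAncestor k s m d i j`: node `i` of the layer that lies `m` layers below the output is an
ancestor of node `j` of the layer that lies another `d` layers below (`i = j` if `d = 0`). -/
def IsAncestor (k s m : ℕ) :
    (d : ℕ) → Fin (width k s m) → Fin (width k s (m + d)) → Prop
  | 0, i, j => i = j
  | d + 1, i, j => ∃ (l : Fin (width k s (m + d))) (r : Fin (2 * k + 1)),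
      IsAncestor k s m d i l ∧ j = child k s (m + d) l r

/-! ### The convolutional network -/

/-- A filter of size `2k+1`, as the Boolean function that it expresses. -/
abbrev BoolFilter (k : ℕ) : Type := (Fin (2 * k + 1) → Bool) → Bool

/-- The regular `(2k+1)`-majority. -/
def majority (k : ℕ) : BoolFilter k :=
  fun x => decide (k < (Finset.univ.filter fun r => x r = true).card)

/-- The weights `θ` have no ties: `∑ θ_r x_r ≠ 0` for every `x ∈ {±1}^(2k+1)`. -/
def NoTies {k : ℕ} (θ : Fin (2 * k + 1) → ℝ) : Prop :=
  ∀ x : Fin (2 * k + 1) → Bool, ∑ r, θ r * sgn (x r) ≠ 0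

/-- The Boolean function `x ↦ sign (∑ θ_r x_r)` expressed by weights `θ` without ties. -/
def weighted {k : ℕ} (θ : Fin (2 * k + 1) → ℝ) : BoolFilter k :=
  fun x => decide (0 < ∑ r, θ r * sgn (x r))

/-- One layer: the same filter is applied to the children of every node. -/
def convLayer (k s m : ℕ) (φ : BoolFilter k) (x : Fin (width k s (m + 1)) → Bool) :
    Fin (width k s m) → Bool :=
  fun i => φ fun r => x (child k s m i r)

/-- The Boolean function induced by the network of depth `n` in which the filter `φ t` computes
layer `t + 1` from layer `t`; layer `0` holds the input bits and layer `n` the output node. -/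
def network (k s : ℕ) : (n : ℕ) → (ℕ → BoolFilter k) → (Fin (width k s n) → Bool) → Bool
  | 0, _, x => x ⟨0, Nat.one_pos⟩
  | n + 1, φ, x => network k s n (fun t => φ (t + 1)) (convLayer k s n (φ 0) x)

/-- The convolutional iterated `(2k+1)`-majority function of depth `n` with stride `s`. -/
def iteratedMajority (k s n : ℕ) : (Fin (width k s n) → Bool) → Bool :=
  network k s n fun _ => majority k

end ConvMaj

end

/-! All filters in play are (almost surely) odd, so the network function `f` has mean zero and its
noise covariance is the sum of `coeff f S ^ 2 * (1 - 2ε) ^ |S|` over nonempty `S`. The proof embeds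
this sum in a family, `blockStab`, whose exponent is the number of blocks of inputs that `S` meets,
and coarsens the blocks from single inputs up to the scale of the whole network. Coarsening never
decreases the value, and the value never exceeds 1. So it suffices that many of the coarsenings gain
a fixed factor.

The gain comes from shielding (`mean_mul_coeff_sq_le`, `shielded_sum_le`). Suppose that with
probability at least `δ` the other inputs of a coarse block make `f` insensitive to one of its fine
blocks. Then Fourier weight cannot concentrate on sets that meet this fine block and nothing else in
the coarse block: it is dominated by the weight on extensions by those other inputs, and such
extensions meet fewer blocks after coarsening.

Majority layers create shields. A short interval of disagreement between two long runs of `true`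
nodes shrinks by the factor `s` in each majority layer and finally disappears (`Agree.node_eq`).
Long runs have probability bounded below at every layer, whatever the odd filters underneath
(`exists_le_run`): a node is a function of `2k+1` consecutive input blocks, a Ramsey theorem
rearranges boundedly many blocks so that a constant run appears, and rearranging does not change the
law of the bits. A fine block near the edge of its coarse block has too few neighbours there, so two
shifted coarsenings are offered and the better one is used (`exists_blockStab_le`).

Hence the covariance is at most `κ ^ j`, where `j` counts the disjoint windows of `q` consecutive
majority layers (`exists_contraction`). For iterated majority every window counts. For random
filters the windows are independent, so the expectation of `κ ^ j` decays exponentially, and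
Markov's inequality gives the quenched statement. The bound on ancestors is a separate estimate of
offsets in the graph. -/

namespace ConvMaj

/-! ### Fourier analysis on the discrete cube -/

section Fourier

variable {ι : Type*} [Fintype ι] [DecidableEq ι]

set_option linter.unusedSectionVars false

/-- The average of a function over the discrete cube. -/
noncomputable def mean (f : (ι → Bool) → ℝ) : ℝ := (∑ ω, f ω) / 2 ^ Fintype.card ι

/-- The character of the discrete cube indexed by `S`. -/
noncomputable def chi (S : Finset ι) (ω : ι → Bool) : ℝ := ∏ i ∈ S, sgn (ω i)

/-- The Fourier coefficient of `f` at `S`. -/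
noncomputable def coeff (f : (ι → Bool) → ℝ) (S : Finset ι) : ℝ := mean fun ω => f ω * chi S ω

/-- Flip the `i`-th bit. -/
def flip (i : ι) (ω : ι → Bool) : ι → Bool := Function.update ω i (!ω i)

theorem flip_flip (i : ι) (ω : ι → Bool) : flip i (flip i ω) = ω := by
  simp [flip]

theorem sgn_mul_self (b : Bool) : sgn b * sgn b = 1 := by cases b <;> simp [sgn]

theorem sgn_not (b : Bool) : sgn (!b) = -sgn b := by cases b <;> simp [sgn]

theorem sgn_xor (a b : Bool) : sgn (xor a b) = sgn a * -sgn b := by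
  cases a <;> cases b <;> simp [sgn]

theorem mean_flip (i : ι) (f : (ι → Bool) → ℝ) : mean (fun ω => f (flip i ω)) = mean f := by
  unfold mean
  congr 1
  exact Equiv.sum_comp (Function.Involutive.toPerm (flip i) (flip_flip i)) f

theorem mean_sum {α : Type*} (s : Finset α) (f : α → (ι → Bool) → ℝ) :
    mean (fun ω => ∑ a ∈ s, f a ω) = ∑ a ∈ s, mean (f a) := by
  simp only [mean, Finset.sum_div]
  exact Finset.sum_comm

theorem mean_const_mul (c : ℝ) (f : (ι → Bool) → ℝ) :
    mean (fun ω => c * f ω) = c * mean f := by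
  simp only [mean, ← Finset.mul_sum, mul_div_assoc]

theorem mean_const (c : ℝ) : mean (fun _ : ι → Bool => c) = c := by
  simp [mean]

theorem chi_flip_of_mem {S : Finset ι} {i : ι} (hi : i ∈ S) (ω : ι → Bool) :
    chi S (flip i ω) = -chi S ω := by
  unfold chi
  rw [← Finset.mul_prod_erase S _ hi, ← Finset.mul_prod_erase S (fun j => sgn (ω j)) hi]
  have : ∏ j ∈ S.erase i, sgn (flip i ω j) = ∏ j ∈ S.erase i, sgn (ω j) :=
    Finset.prod_congr rfl fun j hj => by simp [flip, Finset.ne_of_mem_erase hj]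
  rw [this]
  simp [flip, sgn_not]

theorem chi_mul_chi (S T : Finset ι) (ω : ι → Bool) :
    chi S ω * chi T ω = chi (symmDiff S T) ω := by
  have h : ∀ U : Finset ι, chi U ω = ∏ i, if i ∈ U then sgn (ω i) else 1 := fun U => by
    simp [chi, Finset.prod_ite_mem]
  rw [h, h, h, ← Finset.prod_mul_distrib]
  refine Finset.prod_congr rfl fun i _ => ?_
  by_cases h1 : i ∈ S <;> by_cases h2 : i ∈ T <;> simp [Finset.mem_symmDiff, h1, h2, sgn_mul_self]

/-- Flipping bit `i` preserves the uniform law and `f` but changes the sign of the character. -/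
theorem coeff_eq_zero_of_flip {f : (ι → Bool) → ℝ} {S : Finset ι} {i : ι} (hi : i ∈ S)
    (hf : ∀ ω, f (flip i ω) = f ω) : coeff f S = 0 := by
  have h : coeff f S = -coeff f S := by
    conv_lhs => rw [coeff, ← mean_flip i]
    simp only [hf, chi_flip_of_mem hi]
    rw [coeff, ← neg_one_mul, ← mean_const_mul]
    congr 1
    ext ω
    ring
  linarith

theorem sum_chi_mul_chi (ω ω' : ι → Bool) :
    ∑ S, chi S ω * chi S ω' = if ω = ω' then 2 ^ Fintype.card ι else 0 := by
  have h : ∑ S : Finset ι, chi S ω * chi S ω' = ∏ i, (1 + sgn (ω i) * sgn (ω' i)) := by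
    rw [Finset.prod_one_add]
    simp [chi, Finset.prod_mul_distrib]
  rw [h]
  split_ifs with he
  · subst he
    simp [sgn_mul_self, one_add_one_eq_two]
  · obtain ⟨i, hi⟩ := Function.ne_iff.1 he
    refine Finset.prod_eq_zero (Finset.mem_univ i) ?_
    revert hi
    cases ω i <;> cases ω' i <;> simp [sgn]

theorem fourier_inversion (f : (ι → Bool) → ℝ) (ω : ι → Bool) :
    f ω = ∑ S, coeff f S * chi S ω := by
  have h : ∀ S, coeff f S * chi S ω =
      ∑ ω', f ω' / 2 ^ Fintype.card ι * (chi S ω' * chi S ω) := fun S => by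
    rw [coeff, mean, Finset.sum_div, Finset.sum_mul]
    refine Finset.sum_congr rfl fun ω' _ => ?_
    ring
  simp only [h]
  rw [Finset.sum_comm]
  simp only [← Finset.mul_sum, sum_chi_mul_chi]
  simp

theorem mean_mul (f g : (ι → Bool) → ℝ) :
    mean (fun ω => f ω * g ω) = ∑ S, coeff g S * coeff f S := by
  have h : ∀ ω, f ω * g ω = ∑ S, coeff g S * (f ω * chi S ω) := fun ω => by
    conv_lhs => rw [fourier_inversion g ω, Finset.mul_sum]
    refine Finset.sum_congr rfl fun S _ => ?_
    ring
  simp only [h, mean_sum, mean_const_mul]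
  rfl

theorem coeff_mul (c f : (ι → Bool) → ℝ) (S : Finset ι) :
    coeff (fun ω => c ω * f ω) S = ∑ R, coeff c R * coeff f (symmDiff S R) := by
  have h := mean_mul (fun ω => f ω * chi S ω) c
  have h1 : coeff (fun ω => c ω * f ω) S = mean fun ω => f ω * chi S ω * c ω := by
    unfold coeff
    congr 1
    ext ω
    ring
  rw [h1, h]
  refine Finset.sum_congr rfl fun R _ => ?_
  unfold coeff
  simp only [mul_assoc, chi_mul_chi]

theorem coeff_empty (f : (ι → Bool) → ℝ) : coeff f ∅ = mean f := by
  simp [coeff, chi]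

theorem parseval (f : (ι → Bool) → ℝ) : ∑ S, coeff f S ^ 2 = mean fun ω => f ω ^ 2 := by
  simp only [pow_two, mean_mul]

/-- If, on an event that depends only on the coordinates in `D`, the function `f` does not depend
on the coordinates in `B`, then the Fourier weight of `f` at a set that meets `B` and avoids `D` is
dominated by the weight at its proper extensions by subsets of `D`. -/
theorem mean_mul_coeff_sq_le {f c : (ι → Bool) → ℝ} {B D S : Finset ι}
    (hc : ∀ ω, c ω ^ 2 = c ω) (hcD : ∀ i ∉ D, ∀ ω, c (flip i ω) = c ω)
    (hfB : ∀ i ∈ B, ∀ ω, c ω * f (flip i ω) = c ω * f ω)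
    (hS : ∃ i ∈ S, i ∈ B) (hSD : Disjoint S D) :
    mean c * coeff f S ^ 2 ≤ ∑ R ∈ D.powerset.erase ∅, coeff f (S ∪ R) ^ 2 := by
  obtain ⟨i, hiS, hiB⟩ := hS
  have hiD : i ∉ D := Finset.disjoint_left.1 hSD hiS
  -- The product `c f` ignores a coordinate of `S`. Expanding this vanishing coefficient as a
  -- convolution isolates `mean c * coeff f S` from the terms with nonempty `R ⊆ D`.
  have h0 : coeff (fun ω => c ω * f ω) S = 0 :=
    coeff_eq_zero_of_flip hiS fun ω => by rw [hcD i hiD, hfB i hiB]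
  have h1 : ∀ R, R ∉ D.powerset → coeff c R = 0 := fun R hR => by
    rw [Finset.mem_powerset, Finset.not_subset] at hR
    obtain ⟨j, hjR, hjD⟩ := hR
    exact coeff_eq_zero_of_flip hjR (hcD j hjD)
  rw [coeff_mul, ← Finset.sum_subset (Finset.subset_univ D.powerset)
    (fun R _ hR => by rw [h1 R hR, zero_mul]),
    ← Finset.add_sum_erase _ _ (Finset.empty_mem_powerset D)] at h0
  have h2 : ∑ R ∈ D.powerset.erase ∅, coeff c R * coeff f (symmDiff S R) =
      ∑ R ∈ D.powerset.erase ∅, coeff c R * coeff f (S ∪ R) :=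
    Finset.sum_congr rfl fun R hR => by
      have : Disjoint S R :=
        hSD.mono_right (Finset.mem_powerset.1 (Finset.mem_of_mem_erase hR))
      rw [this.symmDiff_eq_sup]
      rfl
  rw [h2, coeff_empty] at h0
  simp only [← Finset.bot_eq_empty, symmDiff_bot] at h0
  simp only [Finset.bot_eq_empty] at h0
  -- Cauchy–Schwarz; as `c` is an indicator, Parseval bounds its factor by `mean c`, so only one
  -- power of `mean c` is lost.
  have h3 := Finset.sum_mul_sq_le_sq_mul_sq (D.powerset.erase ∅) (coeff c)
    (fun R => coeff f (S ∪ R))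
  have h4 : ∑ R ∈ D.powerset.erase ∅, coeff c R ^ 2 ≤ mean c := by
    have : mean c = ∑ R, coeff c R ^ 2 := by rw [parseval]; simp only [hc]
    rw [this]
    exact Finset.sum_le_sum_of_subset_of_nonneg (Finset.subset_univ _) fun _ _ _ => sq_nonneg _
  have hp : 0 ≤ mean c :=
    div_nonneg (Finset.sum_nonneg fun ω _ => by rw [← hc]; exact sq_nonneg _) (by positivity)
  have h5 : 0 ≤ ∑ R ∈ D.powerset.erase ∅, coeff f (S ∪ R) ^ 2 :=
    Finset.sum_nonneg fun _ _ => sq_nonneg _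
  rcases hp.eq_or_lt with hp | hp
  · rw [← hp, zero_mul]
    exact h5
  · have h6 : (mean c * coeff f S) ^ 2 ≤
        mean c * ∑ R ∈ D.powerset.erase ∅, coeff f (S ∪ R) ^ 2 := by
      rw [eq_neg_of_add_eq_zero_left h0, neg_sq]
      exact h3.trans (mul_le_mul_of_nonneg_right h4 h5)
    refine le_of_mul_le_mul_left ?_ hp
    linarith [h6, mul_pow (mean c) (coeff f S) 2, pow_two (mean c)]

end Fourier

/-! ### Contraction of the block-noise stability under coarsening -/

section Blocks

variable {N : ℕ}

/-- The noise stability of `f` (without its mean) under the noise that treats each of the blocks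
`{y | β y = i}` as a unit: a Fourier character that meets `j` blocks is damped by `l ^ j`. -/
noncomputable def blockStab (l : ℝ) (f : (Fin N → Bool) → ℝ) (β : Fin N → ℕ) : ℝ :=
  ∑ S ∈ Finset.univ.erase ∅, coeff f S ^ 2 * l ^ (S.image β).card

/-- The block of the smallest element of `S`. -/
noncomputable def leadBlock (β : Fin N → ℕ) (S : Finset (Fin N)) : ℕ :=
  if h : S.Nonempty then β (S.min' h) else 0

theorem exists_leadBlock (β : Fin N → ℕ) {S : Finset (Fin N)} (h : S.Nonempty) :
    ∃ y ∈ S, leadBlock β S = β y ∧ ∀ z ∈ S, y ≤ z :=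
  ⟨S.min' h, S.min'_mem h, by simp [leadBlock, h], fun z hz => S.min'_le z hz⟩

theorem blockStab_nonneg {l : ℝ} (hl : 0 ≤ l) (f : (Fin N → Bool) → ℝ) (β : Fin N → ℕ) :
    0 ≤ blockStab l f β :=
  Finset.sum_nonneg fun _ _ => by positivity

theorem card_image_comp_le (β : Fin N → ℕ) (ψ : ℕ → ℕ) (S : Finset (Fin N)) :
    (S.image (ψ ∘ β)).card ≤ (S.image β).card := by
  rw [← Finset.image_image]
  exact Finset.card_image_le

/-- Merging blocks can only reduce the number of blocks that a set meets. This is how layers that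
offer no gain are passed. -/
theorem blockStab_le_comp {l : ℝ} (hl : 0 ≤ l) (hl1 : l ≤ 1) (f : (Fin N → Bool) → ℝ)
    (β : Fin N → ℕ) (ψ : ℕ → ℕ) : blockStab l f β ≤ blockStab l f (ψ ∘ β) :=
  Finset.sum_le_sum fun S _ => mul_le_mul_of_nonneg_left
    (pow_le_pow_of_le_one hl hl1 (card_image_comp_le β ψ S)) (sq_nonneg _)

/-- The coordinates that lie in the same coarse block as block `i`, but not in block `i`. -/
def siblings (β : Fin N → ℕ) (ψ : ℕ → ℕ) (i : ℕ) : Finset (Fin N) :=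
  Finset.univ.filter fun y => ψ (β y) = ψ i ∧ β y ≠ i

/-- With probability at least `δ`, the coordinates in the coarse block of block `i` that lie outside
block `i` take values for which `f` does not depend on block `i`. -/
def Shielded (f : (Fin N → Bool) → ℝ) (β : Fin N → ℕ) (ψ : ℕ → ℕ) (δ : ℝ) (i : ℕ) : Prop :=
  ∃ c : (Fin N → Bool) → ℝ, (∀ ω, c ω ^ 2 = c ω) ∧
    (∀ y ∉ siblings β ψ i, ∀ ω, c (flip y ω) = c ω) ∧
    (∀ y, β y = i → ∀ ω, c ω * f (flip y ω) = c ω * f ω) ∧ δ ≤ mean c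

/-- The gain of a set whose block count drops from `b` to `a`, measured against the weight `l ^ m`
of a set with an intermediate count that charges it. -/
theorem pow_sub_pow_ge {l : ℝ} (hl : 0 ≤ l) (hl1 : l ≤ 1) {a m b : ℕ} (ham : a ≤ m)
    (hmb : m + 1 ≤ b) : (1 - l) * l ^ m ≤ l ^ a - l ^ b := by
  have h1 := pow_le_pow_of_le_one hl hl1 ham
  have h2 := pow_le_pow_of_le_one hl hl1 hmb
  rw [pow_succ] at h2
  linarith

theorem sum_extension_le (f : (Fin N → Bool) → ℝ) {S D : Finset (Fin N)} (hSD : Disjoint S D) :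
    ∑ R ∈ D.powerset.erase ∅, coeff f (S ∪ R) ^ 2 ≤
      ∑ V with V \ D = S ∧ V ≠ S, coeff f V ^ 2 := by
  have hdis : ∀ R ∈ D.powerset.erase ∅, Disjoint S R := fun R hR =>
    hSD.mono_right (Finset.mem_powerset.1 (Finset.mem_of_mem_erase hR))
  have hinj : Set.InjOn (fun R => S ∪ R) (D.powerset.erase ∅ : Finset (Finset (Fin N))) := by
    intro R hR R' hR' h
    have h1 : (S ∪ R) \ S = (S ∪ R') \ S := by
      have h' : S ∪ R = S ∪ R' := h
      rw [h']
    rwa [Finset.union_sdiff_cancel_left (hdis R hR),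
      Finset.union_sdiff_cancel_left (hdis R' hR')] at h1
  rw [← Finset.sum_image (f := fun V => coeff f V ^ 2) hinj]
  refine Finset.sum_le_sum_of_subset_of_nonneg ?_ fun _ _ _ => sq_nonneg _
  intro V hV
  obtain ⟨R, hR, rfl⟩ := Finset.mem_image.1 hV
  have hRD := Finset.mem_powerset.1 (Finset.mem_of_mem_erase hR)
  have hR0 := Finset.ne_of_mem_erase hR
  simp only [Finset.mem_filter, Finset.mem_univ, true_and]
  constructor
  · rw [Finset.union_sdiff_distrib, Finset.sdiff_eq_empty_iff_subset.2 hRD, Finset.union_empty,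
      Finset.sdiff_eq_self_of_disjoint hSD]
  · intro h
    have h2 := hdis R hR
    rw [Finset.union_eq_left] at h
    exact hR0 (Finset.disjoint_self_iff_empty R |>.1 (h2.mono_left h))

theorem blockStab_sub (l : ℝ) (f : (Fin N → Bool) → ℝ) (β : Fin N → ℕ) (ψ : ℕ → ℕ) :
    blockStab l f (ψ ∘ β) - blockStab l f β = ∑ S ∈ Finset.univ.erase ∅,
      coeff f S ^ 2 * (l ^ (S.image (ψ ∘ β)).card - l ^ (S.image β).card) := by
  simp only [blockStab, mul_sub, Finset.sum_sub_distrib]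

/-- A set `V` that extends `S` by some siblings of the leading block of `S` meets more blocks. -/
theorem extension_facts (β : Fin N → ℕ) (ψ : ℕ → ℕ) {S V : Finset (Fin N)} (hS : S.Nonempty)
    (hV : V \ siblings β ψ (leadBlock β S) = S) (hne : V ≠ S) :
    V.Nonempty ∧ ψ (leadBlock β V) = ψ (leadBlock β S) ∧
      (V.image (ψ ∘ β)).card ≤ (S.image β).card ∧ (S.image β).card + 1 ≤ (V.image β).card := by
  obtain ⟨y, hyS, hy, hmin⟩ := exists_leadBlock β hS
  have hSV : S ⊆ V := by rw [← hV]; exact Finset.sdiff_subset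
  have hVne : V.Nonempty := hS.mono hSV
  have hsib : ∀ z ∈ V, z ∉ S → ψ (β z) = ψ (leadBlock β S) ∧ β z ≠ leadBlock β S := by
    intro z hz hzS
    rw [← hV, Finset.mem_sdiff, not_and, not_not] at hzS
    simpa [siblings] using hzS hz
  refine ⟨hVne, ?_, ?_, ?_⟩
  · obtain ⟨z, hzV, hz, hzmin⟩ := exists_leadBlock β hVne
    by_cases hzS : z ∈ S
    · rw [hz, hy, le_antisymm (hzmin y (hSV hyS)) (hmin z hzS)]
    · rw [hz, (hsib z hzV hzS).1]
  · refine le_trans (Finset.card_le_card ?_) (card_image_comp_le β ψ S)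
    intro t ht
    obtain ⟨z, hz, rfl⟩ := Finset.mem_image.1 ht
    by_cases hzS : z ∈ S
    · exact Finset.mem_image_of_mem _ hzS
    · refine Finset.mem_image.2 ⟨y, hyS, ?_⟩
      simp only [Function.comp_apply]
      rw [(hsib z hz hzS).1, hy]
  · have hss : S.image β ⊂ V.image β := by
      refine Finset.ssubset_iff_subset_ne.2 ⟨Finset.image_subset_image hSV, fun h => ?_⟩
      obtain ⟨z, hz, hzS⟩ := Finset.exists_of_ssubset (Finset.ssubset_iff_subset_ne.2 ⟨hSV, hne.symm⟩)
      have h1 := Finset.mem_image_of_mem β hz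
      rw [← h] at h1
      obtain ⟨w, hw, hwz⟩ := Finset.mem_image.1 h1
      have h2 := hsib z hz hzS
      rw [← hwz] at h2
      rw [← hV, Finset.mem_sdiff] at hw
      exact hw.2 (by simpa [siblings] using h2)
    exact Finset.card_lt_card hss

-- A charging argument. A set `S` that meets siblings of its leading block loses a block under
-- coarsening and pays for itself. A set that avoids them is paid for by its extensions `V`, which
-- lose a block. Each `V` is charged at most `M` times, which together with the self-payment gives
-- `M + 1`.
open Classical in
theorem shielded_sum_le {l δ : ℝ} (hl : 0 ≤ l) (hl1 : l ≤ 1) (hδ1 : δ ≤ 1)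
    (f : (Fin N → Bool) → ℝ) (β : Fin N → ℕ) (ψ : ℕ → ℕ) (M : ℕ)
    (hM : ∀ i, ∃ F : Finset ℕ, F.card ≤ M ∧ ∀ j, ψ j = i → j ∈ F) :
    δ * (1 - l) * ∑ S ∈ Finset.univ.erase ∅ with Shielded f β ψ δ (leadBlock β S),
        coeff f S ^ 2 * l ^ (S.image β).card ≤
      (M + 1) * (blockStab l f (ψ ∘ β) - blockStab l f β) := by
  classical
  set G := (Finset.univ.erase ∅).filter fun S => Shielded f β ψ δ (leadBlock β S) with hG
  set d : Finset (Fin N) → ℝ := fun S => l ^ (S.image (ψ ∘ β)).card - l ^ (S.image β).card with hd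
  have hd0 : ∀ S, 0 ≤ d S := fun S =>
    sub_nonneg.2 (pow_le_pow_of_le_one hl hl1 (card_image_comp_le β ψ S))
  have hl1' : 0 ≤ 1 - l := sub_nonneg.2 hl1
  have hne : ∀ S ∈ G, S.Nonempty := fun S hS =>
    Finset.nonempty_of_ne_empty (Finset.ne_of_mem_erase (Finset.mem_filter.1 hS).1)
  rw [← Finset.sum_filter_add_sum_filter_not G
    (fun S => Disjoint S (siblings β ψ (leadBlock β S))), mul_add, add_mul, one_mul,
    blockStab_sub]
  refine add_le_add ?_ ?_
  · set I := G.filter fun S => Disjoint S (siblings β ψ (leadBlock β S)) with hI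
    have hIG : ∀ S ∈ I, S ∈ G := fun S hS => (Finset.mem_filter.1 hS).1
    have h1 : ∀ S ∈ I, δ * (1 - l) * (coeff f S ^ 2 * l ^ (S.image β).card) ≤
        ∑ V ∈ Finset.univ.erase ∅,
          if V \ siblings β ψ (leadBlock β S) = S ∧ V ≠ S then coeff f V ^ 2 * d V else 0 := by
      intro S hS
      obtain ⟨c, hc, hcD, hcB, hcδ⟩ := (Finset.mem_filter.1 (hIG S hS)).2
      have hSD := (Finset.mem_filter.1 hS).2
      obtain ⟨y, hyS, hy, -⟩ := exists_leadBlock β (hne S (hIG S hS))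
      have h2 := mean_mul_coeff_sq_le (B := Finset.univ.filter fun y => β y = leadBlock β S)
        hc hcD (fun i hi => hcB i (Finset.mem_filter.1 hi).2) ⟨y, hyS, by simp [hy]⟩ hSD
      have h3 : δ * coeff f S ^ 2 ≤ ∑ V with V \ siblings β ψ (leadBlock β S) = S ∧ V ≠ S,
          coeff f V ^ 2 :=
        (mul_le_mul_of_nonneg_right hcδ (sq_nonneg _)).trans (h2.trans (sum_extension_le f hSD))
      calc δ * (1 - l) * (coeff f S ^ 2 * l ^ (S.image β).card)
          = (δ * coeff f S ^ 2) * ((1 - l) * l ^ (S.image β).card) := by ring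
        _ ≤ (∑ V with V \ siblings β ψ (leadBlock β S) = S ∧ V ≠ S, coeff f V ^ 2) *
            ((1 - l) * l ^ (S.image β).card) :=
          mul_le_mul_of_nonneg_right h3 (by positivity)
        _ ≤ ∑ V with V \ siblings β ψ (leadBlock β S) = S ∧ V ≠ S, coeff f V ^ 2 * d V := by
          rw [Finset.sum_mul]
          refine Finset.sum_le_sum fun V hV => mul_le_mul_of_nonneg_left ?_ (sq_nonneg _)
          obtain ⟨-, hV1, hV2⟩ := Finset.mem_filter.1 hV
          obtain ⟨-, -, h4, h5⟩ := extension_facts β ψ (hne S (hIG S hS)) hV1 hV2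
          exact pow_sub_pow_ge hl hl1 h4 h5
        _ ≤ _ := by
          rw [← Finset.sum_filter]
          refine Finset.sum_le_sum_of_subset_of_nonneg ?_ fun V _ _ =>
            mul_nonneg (sq_nonneg _) (hd0 V)
          intro V hV
          obtain ⟨-, hV1, hV2⟩ := Finset.mem_filter.1 hV
          obtain ⟨h4, -⟩ := extension_facts β ψ (hne S (hIG S hS)) hV1 hV2
          simp [hV1, hV2, h4.ne_empty]
    rw [Finset.mul_sum, Finset.mul_sum]
    refine (Finset.sum_le_sum h1).trans ?_
    rw [Finset.sum_comm]
    refine Finset.sum_le_sum fun V _ => ?_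
    rw [← Finset.sum_filter, Finset.sum_const, nsmul_eq_mul]
    refine mul_le_mul_of_nonneg_right ?_ (mul_nonneg (sq_nonneg _) (hd0 V))
    -- `V` determines `S` once the leading block `i` of `S` is known, as `S = V \ siblings β ψ i`;
    -- and `i` lies in the coarse block of the leading block of `V`, so there are at most `M`
    -- choices.
    obtain ⟨F, hFM, hF⟩ := hM (ψ (leadBlock β V))
    refine Nat.cast_le.2 (le_trans ?_ hFM)
    refine (Finset.card_le_card ?_).trans (Finset.card_image_le (s := F)
      (f := fun i => V \ siblings β ψ i))
    intro S hS
    obtain ⟨hSI, hV1, hV2⟩ := Finset.mem_filter.1 hS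
    obtain ⟨-, h4, -⟩ := extension_facts β ψ (hne S (hIG S hSI)) hV1 hV2
    exact Finset.mem_image.2 ⟨leadBlock β S, hF _ h4.symm, hV1⟩
  · rw [Finset.mul_sum]
    refine (Finset.sum_le_sum fun S hS => ?_).trans
      (Finset.sum_le_sum_of_subset_of_nonneg (f := fun S => coeff f S ^ 2 * d S)
        ((Finset.filter_subset _ _).trans (Finset.filter_subset _ _))
        fun V _ _ => mul_nonneg (sq_nonneg _) (hd0 V))
    obtain ⟨hSG, hSD⟩ := Finset.mem_filter.1 hS
    obtain ⟨y, hyS, hy, -⟩ := exists_leadBlock β (hne S hSG)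
    rw [Finset.not_disjoint_iff] at hSD
    obtain ⟨z, hzS, hz⟩ := hSD
    obtain ⟨hz1, hz2⟩ : ψ (β z) = ψ (leadBlock β S) ∧ β z ≠ leadBlock β S := by
      simpa [siblings] using hz
    have hlt : (S.image (ψ ∘ β)).card + 1 ≤ (S.image β).card := by
      rw [← Finset.image_image]
      refine Nat.lt_of_le_of_ne Finset.card_image_le fun h => hz2 ?_
      have hinj := Finset.card_image_iff.1 h
      rw [hy] at hz1 ⊢
      exact hinj (Finset.mem_coe.2 (Finset.mem_image_of_mem _ hzS))
        (Finset.mem_coe.2 (Finset.mem_image_of_mem _ hyS)) hz1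
    have h1 := pow_sub_pow_ge hl hl1 le_rfl hlt
    have h2 := pow_le_pow_of_le_one hl hl1 (card_image_comp_le β ψ S)
    have h3 : δ * ((1 - l) * l ^ (S.image β).card) ≤ d S :=
      (mul_le_of_le_one_left (by positivity) hδ1).trans
        ((mul_le_mul_of_nonneg_left h2 hl1').trans h1)
    calc δ * (1 - l) * (coeff f S ^ 2 * l ^ (S.image β).card)
        = coeff f S ^ 2 * (δ * ((1 - l) * l ^ (S.image β).card)) := by ring
      _ ≤ _ := mul_le_mul_of_nonneg_left h3 (sq_nonneg _)

/-- If each block is shielded with respect to one of two coarsenings, then the block-noise stability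
contracts by a fixed factor when it is compared to that of a suitable one of the coarsenings. -/
theorem exists_blockStab_le {l δ : ℝ} (hl : 0 ≤ l) (hl1 : l ≤ 1) (hδ : 0 ≤ δ) (hδ1 : δ ≤ 1)
    (f : (Fin N → Bool) → ℝ) (β : Fin N → ℕ) (ψ : Bool → ℕ → ℕ) (M : ℕ)
    (hM : ∀ b i, ∃ F : Finset ℕ, F.card ≤ M ∧ ∀ j, ψ b j = i → j ∈ F)
    (hψ : ∀ y, ∃ b, Shielded f β (ψ b) δ (β y)) :
    ∃ b, blockStab l f β ≤ (1 + δ * (1 - l) / (2 * (M + 1)))⁻¹ * blockStab l f (ψ b ∘ β) := by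
  classical
  set x : Bool → ℝ := fun b =>
    ∑ S ∈ Finset.univ.erase ∅ with Shielded f β (ψ b) δ (leadBlock β S),
        coeff f S ^ 2 * l ^ (S.image β).card with hx
  have hsum : blockStab l f β ≤ x false + x true := by
    simp only [hx, Finset.sum_filter, ← Finset.sum_add_distrib, blockStab]
    refine Finset.sum_le_sum fun S hS => ?_
    obtain ⟨y, -, hy, -⟩ := exists_leadBlock β
      (Finset.nonempty_of_ne_empty (Finset.ne_of_mem_erase hS))
    have h0 : 0 ≤ coeff f S ^ 2 * l ^ (S.image β).card := by positivity
    obtain ⟨b, hb⟩ := hψ y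
    rw [← hy] at hb
    cases b
    · rw [if_pos hb]
      split_ifs <;> linarith
    · rw [if_pos hb]
      split_ifs <;> linarith
  -- One of the two coarsenings shields at least half of the stability; this is the 2 in the
  -- contraction factor.
  have hb : ∃ b, blockStab l f β / 2 ≤ x b := by
    by_contra! h
    have h1 := h false
    have h2 := h true
    linarith
  obtain ⟨b, hb⟩ := hb
  refine ⟨b, ?_⟩
  have h := shielded_sum_le hl hl1 hδ1 f β (ψ b) M (hM b)
  have hl1' : 0 ≤ 1 - l := sub_nonneg.2 hl1
  have hM0 : (0 : ℝ) < M + 1 := by positivity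
  have h1 : δ * (1 - l) * (blockStab l f β / 2) ≤
      (M + 1) * (blockStab l f (ψ b ∘ β) - blockStab l f β) :=
    (mul_le_mul_of_nonneg_left hb (by positivity)).trans h
  have hpos : 0 < 1 + δ * (1 - l) / (2 * (M + 1)) := by positivity
  rw [inv_mul_eq_div, le_div_iff₀ hpos, mul_add, mul_one, mul_div_assoc', ← le_sub_iff_add_le',
    div_le_iff₀ (by positivity)]
  linarith

end Blocks

/-! ### The network on an infinite input sequence -/

section Nodes

variable {k s : ℕ}

/-- The value of node `j` of layer `t`, for an infinite sequence of input bits. -/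
def node (s : ℕ) (φ : ℕ → BoolFilter k) (x : ℕ → Bool) : ℕ → ℕ → Bool
  | 0, j => x j
  | t + 1, j => φ t fun r => node s φ x t (s * j + r)

theorem node_add (φ : ℕ → BoolFilter k) (x : ℕ → Bool) (a b j : ℕ) :
    node s φ x (a + b) j = node s (fun t => φ (a + t)) (node s φ x a) b j := by
  induction b generalizing j with
  | zero => rfl
  | succ b ih =>
    change φ (a + b) _ = φ (a + b) _
    congr 1
    ext r
    exact ih _

/-- The value of a node is a function of the inputs in its receptive field, and the same function
for all nodes of a layer. -/
theorem node_congr (hs : 2 ≤ s) (φ : ℕ → BoolFilter k) {x y : ℕ → Bool} {t i j : ℕ}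
    (h : ∀ v < (2 * k + 1) * s ^ t, x (s ^ t * i + v) = y (s ^ t * j + v)) :
    node s φ x t i = node s φ y t j := by
  induction t generalizing i j with
  | zero => simpa [node] using h 0 (by simp)
  | succ t ih =>
    change φ t _ = φ t _
    congr 1
    ext r
    refine ih fun v hv => ?_
    have hr : (r : ℕ) ≤ 2 * k := Nat.lt_succ_iff.1 r.isLt
    have h1 := h (s ^ t * r + v) (by
      calc s ^ t * r + v < s ^ t * (2 * k) + (2 * k + 1) * s ^ t :=
            add_lt_add_of_le_of_lt (Nat.mul_le_mul_left _ hr) hv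
        _ = s ^ t * (4 * k + 1) := by ring
        _ ≤ s ^ t * ((2 * k + 1) * s) := Nat.mul_le_mul_left _ (by nlinarith)
        _ = (2 * k + 1) * s ^ (t + 1) := by ring)
    have e : ∀ i, s ^ (t + 1) * i + (s ^ t * (r : ℕ) + v) = s ^ t * (s * i + r) + v := fun i => by
      ring
    rwa [e, e] at h1

theorem width_pos (k s m : ℕ) : 0 < width k s m := by
  cases m <;> simp [width]

theorem mul_add_lt_width {m j r : ℕ} (hj : j < width k s m) (hr : r ≤ 2 * k) :
    s * j + r < width k s (m + 1) :=
  child_lt_width k s m ⟨j, hj⟩ ⟨r, Nat.lt_succ_iff.2 hr⟩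

/-- The nodes of the finite network depend only on the nodes of the finite network below. -/
theorem node_congr_width (φ : ℕ → BoolFilter k) {x y : ℕ → Bool} {m t j : ℕ}
    (h : ∀ i < width k s (m + t), x i = y i) (hj : j < width k s m) :
    node s φ x t j = node s φ y t j := by
  induction t generalizing m j with
  | zero => exact h j hj
  | succ t ih =>
    change φ t _ = φ t _
    congr 1
    ext r
    refine ih (m := m + 1) (fun i hi => h i ?_)
      (mul_add_lt_width hj (Nat.lt_succ_iff.1 r.isLt))
    rwa [← add_assoc, add_right_comm]

/-- Extend a finite sequence of bits. -/
def extend {N : ℕ} (ω : Fin N → Bool) (i : ℕ) : Bool := if h : i < N then ω ⟨i, h⟩ else true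

theorem network_eq_node (n : ℕ) (φ : ℕ → BoolFilter k) (ω : Fin (width k s n) → Bool) :
    network k s n φ ω = node s φ (extend ω) n 0 := by
  induction n generalizing φ with
  | zero => simp [network, node, extend, width]
  | succ n ih =>
    have h1 := node_add (s := s) φ (extend ω) 1 n 0
    rw [add_comm 1 n] at h1
    rw [network, ih, h1]
    have h : ∀ i < width k s (0 + n),
        extend (convLayer k s n (φ 0) ω) i = node s φ (extend ω) 1 i := by
      intro i hi
      rw [zero_add] at hi
      change _ = φ 0 fun r => extend ω (s * i + r)
      simp only [extend, hi, dif_pos, convLayer]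
      congr 1
      ext r
      rw [dif_pos (mul_add_lt_width hi (Nat.lt_succ_iff.1 r.isLt))]
      rfl
    rw [node_congr_width (m := 0) _ h (width_pos k s 0)]
    simp only [add_comm 1]

/-- A filter is odd if it commutes with the global flip. -/
def OddFilter (φ : BoolFilter k) : Prop := ∀ x, φ (fun r => !x r) = !φ x

theorem node_not {φ : ℕ → BoolFilter k} {t : ℕ} (hφ : ∀ a < t, OddFilter (φ a)) (x : ℕ → Bool)
    (j : ℕ) : node s φ (fun i => !x i) t j = !node s φ x t j := by
  induction t generalizing j with
  | zero => rfl
  | succ t ih =>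
    change φ t _ = !φ t _
    rw [← hφ t (Nat.lt_succ_self t)]
    congr 1
    ext r
    exact ih (fun a ha => hφ a (ha.trans (Nat.lt_succ_self t))) _

theorem network_not {φ : ℕ → BoolFilter k} {n : ℕ} (hφ : ∀ a < n, OddFilter (φ a))
    (ω : Fin (width k s n) → Bool) :
    network k s n φ (fun i => !ω i) = !network k s n φ ω := by
  rw [network_eq_node, network_eq_node, ← node_not hφ]
  refine node_congr_width (m := 0) φ (fun i hi => ?_) (width_pos k s 0)
  rw [zero_add] at hi
  simp [extend, hi]

/-! ### Oddness of the filters, and inputs that force a majority -/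

theorem oddFilter_majority (k : ℕ) : OddFilter (majority k) := by
  intro x
  have h := Finset.card_filter_add_card_filter_not (s := Finset.univ) (fun r => x r = true)
  simp only [Finset.card_univ, Fintype.card_fin, Bool.not_eq_true] at h
  simp only [majority, Bool.not_eq_true']
  rw [← decide_not, decide_eq_decide]
  omega

theorem oddFilter_weighted {θ : Fin (2 * k + 1) → ℝ} (h : NoTies θ) : OddFilter (weighted θ) := by
  intro x
  simp only [weighted, sgn_not, mul_neg, Finset.sum_neg_distrib]
  rw [← decide_not, decide_eq_decide, not_lt, Left.neg_pos_iff]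
  exact ⟨le_of_lt, fun h' => lt_of_le_of_ne h' (h x)⟩

theorem majority_eq_true {x : Fin (2 * k + 1) → Bool} {T : Finset (Fin (2 * k + 1))}
    (hT : k < T.card) (h : ∀ r ∈ T, x r = true) : majority k x = true := by
  rw [majority, decide_eq_true_eq]
  exact hT.trans_le (Finset.card_le_card fun r hr => by simp [h r hr])

/-- A majority node is `true` if the children numbered `c, …, c + k` are. -/
theorem majority_eq_true_of_run {x : Fin (2 * k + 1) → Bool} {c : ℕ} (hc : c ≤ k)
    (h : ∀ r : Fin (2 * k + 1), c ≤ r → (r : ℕ) ≤ c + k → x r = true) : majority k x = true := by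
  have hinj : Function.Injective fun i : Fin (k + 1) => (⟨c + i, by omega⟩ : Fin (2 * k + 1)) :=
    fun i j hij => Fin.ext (by simpa using Fin.mk.inj_iff.1 hij)
  refine majority_eq_true (T := Finset.univ.image
    fun i : Fin (k + 1) => (⟨c + i, by omega⟩ : Fin (2 * k + 1))) ?_ ?_
  · rw [Finset.card_image_of_injective _ hinj]
    simp
  · intro r hr
    obtain ⟨i, -, rfl⟩ := Finset.mem_image.1 hr
    exact h _ (by simp) (by simpa using Nat.lt_succ_iff.1 i.isLt)

/-- `x` and `y` agree outside `[a, b)`, and are `true` on the adjacent windows of length `R`. -/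
def Agree (a b R : ℕ) (x y : ℕ → Bool) : Prop :=
  (∀ i, i < a ∨ b ≤ i → x i = y i) ∧ (∀ i, i < a → a ≤ i + R → x i = true) ∧
    ∀ i, b ≤ i → i < b + R → x i = true

/-- The radii of the windows that are needed for a given number of layers. -/
def radius (k s : ℕ) : ℕ → ℕ
  | 0 => 2 * k + 1
  | p + 1 => 2 * k + 1 + s * radius k s p

theorem Agree.symm {a b R : ℕ} {x y : ℕ → Bool} (h : Agree a b R x y) : Agree a b R y x := by
  obtain ⟨h1, h2, h3⟩ := h
  exact ⟨fun i hi => (h1 i hi).symm, fun i hi hi' => by rw [← h1 i (Or.inl hi), h2 i hi hi'],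
    fun i hi hi' => by rw [← h1 i (Or.inr hi), h3 i hi hi']⟩

/-- The condition `s * j + k < a` puts the first `k + 1` children, a strict majority, to the left of
`a`; the other condition keeps them inside the window. -/
theorem Agree.left_majority {a b R : ℕ} {x y : ℕ → Bool}
    (h : Agree a b R x y) {j : ℕ} (hj : s * j + k < a) (hR : a ≤ s * j + R) :
    (majority k fun r => x (s * j + r)) = true := by
  refine majority_eq_true_of_run (c := 0) (Nat.zero_le k) fun r _ hr => h.2.1 _ ?_ ?_ <;> omega

theorem Agree.right_majority {a b R : ℕ} {x y : ℕ → Bool}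
    (h : Agree a b R x y) {j : ℕ} (hj : b ≤ s * j + k) (hR : s * j + 2 * k < b + R) :
    (majority k fun r => x (s * j + r)) = true := by
  refine majority_eq_true_of_run (c := k) le_rfl fun r hr hr' => h.2.2 _ ?_ ?_ <;> omega

/-- One majority layer divides the length of the interval of disagreement by the stride. -/
theorem Agree.step {a b R a' b' : ℕ} {x y : ℕ → Bool}
    (h : Agree a b (2 * k + 1 + s * R) x y)
    (ha : ∀ j, j < a' ↔ s * j + k < a) (hb : ∀ j, j < b' ↔ s * j + k < b) :
    Agree a' b' R (fun j => majority k fun r => x (s * j + r))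
      (fun j => majority k fun r => y (s * j + r)) := by
  have hb' : ∀ j, b' ≤ j → b ≤ s * j + k := fun j hj => by
    have := (hb j).not.1 (by omega)
    omega
  have hl : ∀ j, j < a' → a' ≤ j + R → a ≤ s * j + (2 * k + 1 + s * R) := by
    intro j hj hj'
    have h1 := (ha (j + R)).not.1 (by omega)
    rw [mul_add] at h1
    omega
  have hr : ∀ j, b' ≤ j → j < b' + R → s * j + 2 * k < b + (2 * k + 1 + s * R) := by
    intro j hj hj'
    -- For `b' = 0` there is no node `b' - 1` to compare with, but then `j < R`.
    rcases Nat.eq_zero_or_pos b' with h0 | h0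
    · have := Nat.mul_le_mul_left s (show j ≤ R by omega)
      omega
    · have h1 := (hb (b' - 1)).1 (by omega)
      have h2 := Nat.mul_le_mul_left s (show j ≤ (b' - 1) + R by omega)
      rw [mul_add] at h2
      omega
  refine ⟨?_, fun j hj hj' => h.left_majority ((ha j).1 hj) (hl j hj hj'),
    fun j hj hj' => h.right_majority (hb' j hj) (hr j hj hj')⟩
  rintro j (hj | hj)
  -- Either all children lie where the sequences agree, or the node is close enough to the interval
  -- that the window forces both values to be `true`.
  · by_cases h1 : s * j + 2 * k < a
    · simp only
      congr 1
      ext r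
      exact h.1 _ (Or.inl (by omega))
    · have h2 : a ≤ s * j + (2 * k + 1 + s * R) := by omega
      simp only
      rw [h.left_majority ((ha j).1 hj) h2, h.symm.left_majority ((ha j).1 hj) h2]
  · by_cases h1 : b ≤ s * j
    · simp only
      congr 1
      ext r
      exact h.1 _ (Or.inr (by omega))
    · have h2 : s * j + 2 * k < b + (2 * k + 1 + s * R) := by omega
      simp only
      rw [h.right_majority (hb' j hj) h2, h.symm.right_majority (hb' j hj) h2]

/-- Disagreement on a single node is corrected by one majority layer. -/
theorem Agree.correct (hk : 1 ≤ k) {a b R : ℕ} {x y : ℕ → Bool} (h : Agree a b R x y)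
    (hab : b ≤ a + 1) (hab' : a ≤ b) (hR : 2 * k + 1 ≤ R) (j : ℕ) :
    (majority k fun r => x (s * j + r)) = majority k fun r => y (s * j + r) := by
  by_cases h1 : s * j ≤ a ∧ a ≤ s * j + 2 * k
  · have key : ∀ z w : ℕ → Bool, Agree a b R z w →
        (majority k fun r => z (s * j + r)) = true := by
      intro z w hz
      -- The remaining `2k` children form a strict majority because `k ≥ 1`.
      refine majority_eq_true (T := Finset.univ.erase ⟨a - s * j, by omega⟩) ?_ ?_
      · rw [Finset.card_erase_of_mem (Finset.mem_univ _), Finset.card_univ, Fintype.card_fin]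
        omega
      · intro r hr
        have h2 := Finset.ne_of_mem_erase hr
        rw [Ne, Fin.ext_iff] at h2
        simp only at h2
        rcases lt_or_ge (s * j + r) a with h3 | h3
        · exact hz.2.1 _ h3 (by omega)
        · exact hz.2.2 _ (by omega) (by omega)
    rw [key x y h, key y x h.symm]
  · congr 1
    ext r
    exact h.1 _ (by omega)

/-- The new endpoint is the rounded-up quotient of `a - k` by `s`; truncated subtraction gives the
correct value 0 when `a ≤ k`. -/
theorem lt_ceilDiv_iff (hs : 0 < s) (a k j : ℕ) : j < (a - k + (s - 1)) / s ↔ s * j + k < a := by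
  rw [Nat.lt_iff_add_one_le, Nat.le_div_iff_mul_le hs, add_mul, mul_comm j s]
  omega

/-- Iterated majority corrects disagreement on a short interval that is surrounded by long
intervals of nodes with value `true`. -/
theorem Agree.node_eq (hk : 1 ≤ k) (hs : 2 ≤ s) {p a b : ℕ} {x y : ℕ → Bool} {φ : ℕ → BoolFilter k}
    (hφ : ∀ t ≤ p, φ t = majority k) (h : Agree a b (radius k s p) x y) (hab : a ≤ b)
    (hL : b ≤ a + s ^ p) (j : ℕ) : node s φ x (p + 1) j = node s φ y (p + 1) j := by
  induction p generalizing a b x y φ j with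
  | zero =>
    change φ 0 _ = φ 0 _
    rw [hφ 0 le_rfl]
    exact h.correct hk (by simpa using hL) hab le_rfl j
  | succ p ih =>
    have h0 : ∀ z, node s φ z (p + 1 + 1) j =
        node s (fun t => φ (1 + t)) (node s φ z 1) (p + 1) j := fun z => by
      rw [← node_add, add_comm 1 (p + 1)]
    rw [h0, h0]
    have hs0 : 0 < s := by omega
    have ha := lt_ceilDiv_iff hs0 a k
    have hb := lt_ceilDiv_iff hs0 b k
    set a' := (a - k + (s - 1)) / s
    set b' := (b - k + (s - 1)) / s
    refine ih (a := a') (b := b') (fun t ht => hφ (1 + t) (by omega)) ?_ ?_ ?_ j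
    · have h1 := h.step ha hb
      have h2 : ∀ z : ℕ → Bool, node s φ z 1 = fun j => majority k fun r => z (s * j + r) := by
        intro z
        ext j
        change φ 0 _ = _
        rw [hφ 0 (by omega)]
        rfl
      rw [h2, h2]
      exact h1
    · refine le_of_not_gt fun h1 => ?_
      have h2 := (ha b').1 h1
      have h3 := (hb b').not.1 (lt_irrefl _)
      omega
    · refine le_of_not_gt fun h1 => ?_
      have h2 := (hb (a' + s ^ p)).1 h1
      have h3 := (ha a').not.1 (lt_irrefl _)
      rw [mul_add, ← pow_succ'] at h2
      omega

end Nodes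

/-! ### A Ramsey theorem for tight paths -/

open Classical in
/-- For every finite colouring of the `(r+1)`-tuples of numbers below a suitable `N`, there is an
increasing sequence of which `W` consecutive tuples have the same colour. -/
theorem exists_monochromatic_path (r : ℕ) : ∀ (C : Type) [Fintype C] (W : ℕ), ∃ N : ℕ,
    ∀ χ : (Fin (r + 1) → ℕ) → C, ∃ a : ℕ → ℕ, (∀ i j, i < j → j < W + r → a i < a j) ∧
      (∀ i < W + r, a i < N) ∧ ∃ c, ∀ i < W, χ (fun t => a (i + t)) = c := by
  induction r with
  | zero =>
    intro C _ W
    refine ⟨Fintype.card C * W + 1, fun χ => ?_⟩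
    obtain ⟨c, -, hc⟩ := Finset.exists_lt_card_fiber_of_mul_lt_card_of_maps_to
      (s := Finset.range (Fintype.card C * W + 1)) (t := Finset.univ) (n := W)
      (f := fun v => χ fun _ => v) (fun _ _ => Finset.mem_univ _) (by simp)
    set T := {v ∈ Finset.range (Fintype.card C * W + 1) | χ (fun _ => v) = c} with hT
    have hfin : {v | v ∈ T}.Finite := T.finite_toSet
    have hcard : hfin.toFinset.card = T.card := congrArg Finset.card (by ext v; simp)
    have hmem : ∀ i < W, Nat.nth (· ∈ T) i ∈ T := fun i hi =>
      Nat.nth_mem_of_lt_card hfin (by rw [hcard]; omega)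
    refine ⟨Nat.nth (· ∈ T), fun i j hij hj => ?_, fun i hi => ?_, c, fun i hi => ?_⟩
    · exact Nat.nth_lt_nth_of_lt_card hfin hij (by rw [hcard]; omega)
    · exact Finset.mem_range.1 (Finset.mem_filter.1 (hmem i hi)).1
    · have h := (Finset.mem_filter.1 (hmem i hi)).2
      rw [← h]
      congr 1
      ext t
      rw [Fin.val_eq_zero t, add_zero]
  | succ r ih =>
    intro C _ W
    -- Label an `(r+1)`-tuple by the function that sends each colour to the length, capped at `W`,
    -- of the longest path of that colour ending in the tuple. Two consecutive tuples with equal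
    -- labels are enough.
    obtain ⟨N, hN⟩ := ih (C → Fin (W + 1)) 2
    refine ⟨N, fun χ => ?_⟩
    set P : (Fin (r + 1) → ℕ) → C → ℕ → Prop := fun u c m => ∃ b : ℕ → ℕ,
      (∀ i j, i < j → j < m + (r + 1) → b i < b j) ∧ (∀ i < m + (r + 1), b i < N) ∧
      (∀ i < m, χ (fun t => b (i + t)) = c) ∧ ∀ t : Fin (r + 1), b (m + t) = u t with hP
    obtain ⟨a, ha, haN, L, hL⟩ := hN fun u c =>
      ⟨Nat.findGreatest (P u c) W, Nat.lt_succ_iff.2 (Nat.findGreatest_le W)⟩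
    -- The two tuples together form an `(r+2)`-tuple of colour `c`. It prolongs any path of colour
    -- `c` ending in the first tuple to one ending in the second, so equal labels force the cap `W`.
    set c := χ fun t => a (0 + t) with hc
    have h0 := congrArg Fin.val (congrFun (hL 0 (by omega)) c)
    have h1 := congrArg Fin.val (congrFun (hL 1 (by omega)) c)
    simp only at h0 h1
    have hbase : P (fun t => a (0 + t)) c 0 :=
      ⟨a, fun i j hij hj => ha i j hij (by omega), fun i hi => haN i (by omega),
        fun i hi => absurd hi (Nat.not_lt_zero i), fun t => rfl⟩
    have hspec : P (fun t => a (0 + t)) c (L c).val := by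
      rw [← h0]
      exact Nat.findGreatest_spec (Nat.zero_le W) hbase
    obtain ⟨b, hb, hbN, hbc, hbu⟩ := hspec
    have hLW : (L c : ℕ) ≤ W := Nat.lt_succ_iff.1 (L c).isLt
    rcases hLW.eq_or_lt with hLW | hLW
    · rw [hLW] at hb hbN hbc
      exact ⟨b, hb, hbN, c, hbc⟩
    · exfalso
      set m : ℕ := (L c).val with hm
      have hba : ∀ x, m ≤ x → x < m + (r + 1) → b x = a (x - m) := by
        intro x hx hx'
        have := hbu ⟨x - m, by omega⟩
        simp only [zero_add] at this
        rw [← this]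
        congr 1
        omega
      set b' : ℕ → ℕ := fun x => if x < m + (r + 1) then b x else a (r + 1) with hb'
      have hb'a : ∀ x, m ≤ x → x < m + (r + 2) → b' x = a (x - m) := by
        intro x hx hx'
        simp only [hb']
        split_ifs with h
        · exact hba x hx h
        · congr 1
          omega
      have hstep : P (fun t => a (1 + t)) c (m + 1) := by
        refine ⟨b', fun i j hij hj => ?_, fun i hi => ?_, fun i hi => ?_, fun t => ?_⟩
        · by_cases h : j < m + (r + 1)
          · simp only [hb', h, hij.trans h, if_true]
            exact hb i j hij h
          · rw [hb'a j (by omega) (by omega)]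
            have hi : i < m + (r + 1) := by omega
            rcases lt_or_ge i m with him | him
            · have h2 := hb i m him (by omega)
              rw [hba m le_rfl (by omega)] at h2
              simp only [hb', hi, if_true]
              exact h2.trans (ha _ _ (by omega) (by omega))
            · rw [hb'a i him (by omega)]
              exact ha _ _ (by omega) (by omega)
        · simp only [hb']
          split_ifs with h
          · exact hbN i h
          · exact haN _ (by omega)
        · rcases Nat.lt_succ_iff_lt_or_eq.1 hi with h | h
          · rw [← hbc i h]
            congr 1
            ext t
            simp only [hb']
            rw [if_pos (by omega)]
          · rw [hc]
            congr 1
            ext t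
            rw [hb'a _ (by omega) (by omega)]
            congr 1
            omega
        · rw [hb'a _ (by omega) (by omega)]
          congr 1
          omega
      have := Nat.le_findGreatest (P := P (fun t => a (1 + t)) c) (n := W) hLW hstep
      omega

/-! ### Fair coins -/

theorem isProbabilityMeasure_coin {p : ℝ} (hp : 0 ≤ p) (hp1 : p ≤ 1) :
    IsProbabilityMeasure (coin p) := by
  constructor
  rw [coin, Measure.add_apply, Measure.smul_apply, Measure.smul_apply, measure_univ, measure_univ,
    smul_eq_mul, smul_eq_mul, mul_one, mul_one, ← ENNReal.ofReal_add hp (by linarith)]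
  simp

instance : IsProbabilityMeasure (coin (1 / 2)) :=
  isProbabilityMeasure_coin (by norm_num) (by norm_num)

theorem coin_half_map_not : (coin (1 / 2)).map (fun b => !b) = coin (1 / 2) := by
  have h : Measurable fun b : Bool => !b := measurable_of_countable _
  rw [coin, Measure.map_add _ _ h, Measure.map_smul, Measure.map_smul, Measure.map_dirac,
    Measure.map_dirac, add_comm]
  norm_num

/-- Independent identically distributed coordinates keep their joint law when they are selected
without repetition in any order. -/
theorem infinitePi_map_comp {ι κ X : Type*} [MeasurableSpace X] (ν : Measure X)
    [IsProbabilityMeasure ν] {e : ι → κ} (he : Function.Injective e) :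
    (Measure.infinitePi fun _ : κ => ν).map (fun x i => x (e i)) =
      Measure.infinitePi fun _ : ι => ν := by
  classical
  refine Measure.eq_infinitePi _ fun s t ht => ?_
  rw [Measure.map_apply (by fun_prop) (.pi s.countable_toSet fun _ _ => ht _)]
  have h : (fun (x : κ → X) i => x (e i)) ⁻¹' ((s : Set ι).pi t) =
      ((s.image e : Finset κ) : Set κ).pi fun j => ⋂ (i : ι) (_ : e i = j), t i := by
    ext x
    simp only [Set.mem_preimage, Set.mem_pi, Finset.mem_coe, Finset.mem_image, Set.mem_iInter]
    constructor
    · rintro h _ ⟨i, hi, rfl⟩ j hj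
      rw [he hj]
      exact h i hi
    · exact fun h i hi => h (e i) ⟨i, hi, rfl⟩ i rfl
  have h2 : ∀ i, (⋂ (j : ι) (_ : e j = e i), t j) = t i := fun i => by
    ext x
    simp [he.eq_iff]
  rw [h, Measure.infinitePi_pi, Finset.prod_image he.injOn]
  · simp only [h2]
  · intro j hj
    obtain ⟨i, -, rfl⟩ := Finset.mem_image.1 hj
    rw [h2]
    exact ht i

/-- The law of an infinite sequence of fair bits. -/
noncomputable def fairBits : Measure (ℕ → Bool) := Measure.infinitePi fun _ => coin (1 / 2)

instance : IsProbabilityMeasure fairBits := by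
  unfold fairBits
  infer_instance

theorem fairBits_real_comp {e : ℕ → ℕ} (he : Function.Injective e) {E : Set (ℕ → Bool)}
    (hE : MeasurableSet E) : fairBits.real {x | (fun i => x (e i)) ∈ E} = fairBits.real E := by
  conv_rhs => rw [fairBits, ← infinitePi_map_comp (coin (1 / 2)) he,
    map_measureReal_apply (by fun_prop) hE]
  rfl

theorem fairBits_real_not {E : Set (ℕ → Bool)} (hE : MeasurableSet E) :
    fairBits.real {x | (fun i => !x i) ∈ E} = fairBits.real E := by
  have h := Measure.infinitePi_map_pi (μ := fun _ : ℕ => coin (1 / 2))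
    (f := fun _ b => !b) (fun _ => measurable_of_countable _)
  simp only [coin_half_map_not] at h
  have hm : Measurable fun (x : ℕ → Bool) i => !x i :=
    measurable_pi_lambda _ fun i => (measurable_of_countable not).comp (measurable_pi_apply i)
  conv_rhs => rw [fairBits, ← h, map_measureReal_apply hm hE]
  rfl

/-! ### Runs of equal nodes -/

section Runs

variable {k s : ℕ}

theorem measurable_node (φ : ℕ → BoolFilter k) (t j : ℕ) :
    Measurable fun x => node s φ x t j := by
  induction t generalizing j with
  | zero => exact measurable_pi_apply j
  | succ t ih =>
    exact (measurable_of_countable (φ t)).comp (measurable_pi_lambda _ fun r => ih _)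

theorem measurableSet_run (φ : ℕ → BoolFilter k) (t K : ℕ) (c : Bool) :
    MeasurableSet {x | ∀ i < K, node s φ x t i = c} := by
  simp only [Set.ofPred_forall]
  exact MeasurableSet.iInter fun i => MeasurableSet.iInter fun _ =>
    measurable_node φ t i (measurableSet_singleton c)

/-- Replace block `i` of length `u` by block `a i`. -/
def reblock (u : ℕ) (a : ℕ → ℕ) (y : ℕ) : ℕ := u * a (y / u) + y % u

theorem reblock_apply {u : ℕ} (a : ℕ → ℕ) (i : ℕ) {v : ℕ} (hv : v < u) :
    reblock u a (u * i + v) = u * a i + v := by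
  rw [reblock, Nat.mul_add_div (by omega), Nat.div_eq_of_lt hv, Nat.mul_add_mod,
    Nat.mod_eq_of_lt hv, add_zero]

theorem reblock_injective {u : ℕ} (hu : 0 < u) {a : ℕ → ℕ} (ha : Function.Injective a) :
    Function.Injective (reblock u a) := by
  intro x y h
  have hx := Nat.mod_lt x hu
  have hy := Nat.mod_lt y hu
  have h1 := congrArg (· / u) h
  have h2 := congrArg (· % u) h
  simp only [reblock, Nat.mul_add_div hu, Nat.div_eq_of_lt hx, Nat.div_eq_of_lt hy, add_zero,
    Nat.mul_add_mod, Nat.mod_mod] at h1 h2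
  rw [← Nat.div_add_mod x u, ← Nat.div_add_mod y u, ha h1, h2]

/-- A node computed from rearranged blocks. -/
theorem node_reblock_congr (hs : 2 ≤ s) (φ : ℕ → BoolFilter k) (x : ℕ → Bool) {t i j : ℕ}
    {a b : ℕ → ℕ} (h : ∀ v < 2 * k + 1, a (i + v) = b (j + v)) :
    node s φ (fun y => x (reblock (s ^ t) a y)) t i =
      node s φ (fun y => x (reblock (s ^ t) b y)) t j := by
  have hu : 0 < s ^ t := by positivity
  refine node_congr hs φ fun v hv => ?_
  have hv1 : v / s ^ t < 2 * k + 1 := (Nat.div_lt_iff_lt_mul hu).2 hv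
  have hv2 := Nat.mod_lt v hu
  have e : ∀ i, s ^ t * i + v = s ^ t * (i + v / s ^ t) + v % s ^ t := fun i => by
    rw [mul_add, add_assoc, Nat.div_add_mod]
  rw [e i, e j, reblock_apply _ _ hv2, reblock_apply _ _ hv2, h _ hv1]

/-- Whatever the odd filters are, a run of `K` nodes with value `true` has a probability that is
bounded below in terms of `k` and `K` only. -/
theorem exists_le_run (k K : ℕ) : ∃ δ : ℝ, 0 < δ ∧ δ ≤ 1 ∧ ∀ (s : ℕ) (_ : 2 ≤ s)
    (φ : ℕ → BoolFilter k) (t : ℕ), (∀ a < t, OddFilter (φ a)) →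
      δ ≤ fairBits.real {x | ∀ i < K, node s φ x t i = true} := by
  classical
  obtain ⟨N, hN⟩ := exists_monochromatic_path (2 * k) Bool K
  -- The union bound runs over at most `N ^ (K + 2k)` choices of blocks and two values of the run;
  -- `N + 1` keeps `D` positive.
  set D : ℝ := 2 * ((N : ℝ) + 1) ^ (K + 2 * k) with hD
  have hD1 : 1 ≤ D := by
    have : (1 : ℝ) ≤ ((N : ℝ) + 1) ^ (K + 2 * k) := one_le_pow₀ (by simp)
    linarith
  refine ⟨D⁻¹, by positivity, inv_le_one_of_one_le₀ hD1, fun s hs φ t hφ => ?_⟩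
  have hu : 0 < s ^ t := by positivity
  set E : Bool → Set (ℕ → Bool) := fun c => {x | ∀ i < K, node s φ x t i = c} with hE
  have hEm : ∀ c, MeasurableSet (E c) := measurableSet_run φ t K
  have hflip : fairBits.real (E false) = fairBits.real (E true) := by
    rw [← fairBits_real_not (hEm false)]
    congr 1
    ext x
    simp [hE, node_not hφ]
  -- Blocks numbered from `N` on fill the rest, so an injective choice extends to an injective
  -- sequence.
  set ext : (Fin (K + 2 * k) → Fin N) → ℕ → ℕ := fun a i =>
    if h : i < K + 2 * k then a ⟨i, h⟩ else N + i with hext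
  have hinj : ∀ a, Function.Injective a → Function.Injective (ext a) := by
    intro a ha i j hij
    simp only [hext] at hij
    split_ifs at hij with h1 h2 h2
    · exact Fin.mk.inj_iff.1 (ha (Fin.ext hij))
    · omega
    · omega
    · omega
  have hcover : (Set.univ : Set (ℕ → Bool)) ⊆
      ⋃ a ∈ Finset.univ.filter fun a : Fin (K + 2 * k) → Fin N => Function.Injective a,
        {x | (fun y => x (reblock (s ^ t) (ext a) y)) ∈ E false ∪ E true} := by
    intro x _
    -- The colour of a tuple of blocks is the value of a node whose receptive field is filled with
    -- these blocks in order.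
    obtain ⟨a, ha, haN, c, hc⟩ := hN fun u => node s φ
      (fun y => x (reblock (s ^ t) (fun i => if h : i < 2 * k + 1 then u ⟨i, h⟩ else 0) y)) t 0
    simp only [Set.mem_iUnion, Finset.mem_filter, Finset.mem_univ, true_and]
    refine ⟨fun i => ⟨a i, haN i i.isLt⟩, fun i j hij => ?_, ?_⟩
    · rcases lt_trichotomy i j with h | h | h
      · have := ha i j h j.isLt
        simp only [Fin.mk.injEq] at hij
        omega
      · exact h
      · have := ha j i h i.isLt
        simp only [Fin.mk.injEq] at hij
        omega
    · have key : ∀ i < K, node s φ (fun y => x (reblock (s ^ t)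
          (ext fun i => ⟨a i, haN i i.isLt⟩) y)) t i = c := by
        intro i hi
        rw [← hc i hi]
        refine node_reblock_congr hs φ x fun v hv => ?_
        simp only [hext, zero_add, hv, dif_pos]
        rw [dif_pos (by omega)]
      cases c
      · exact Or.inl key
      · exact Or.inr key
  have h1 : (1 : ℝ) ≤ ∑ a ∈ Finset.univ.filter
      fun a : Fin (K + 2 * k) → Fin N => Function.Injective a,
      fairBits.real {x | (fun y => x (reblock (s ^ t) (ext a) y)) ∈ E false ∪ E true} := by
    rw [← probReal_univ (μ := fairBits)]
    exact (measureReal_mono hcover (measure_ne_top _ _)).trans (measureReal_biUnion_finset_le _ _)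
  have h2 : ∑ a ∈ Finset.univ.filter
      fun a : Fin (K + 2 * k) → Fin N => Function.Injective a,
      fairBits.real {x | (fun y => x (reblock (s ^ t) (ext a) y)) ∈ E false ∪ E true} ≤
      ∑ a : Fin (K + 2 * k) → Fin N, 2 * fairBits.real (E true) := by
    refine (Finset.sum_le_sum fun a ha => ?_).trans (Finset.sum_le_sum_of_subset_of_nonneg
      (Finset.filter_subset _ _) fun _ _ _ => by positivity)
    rw [fairBits_real_comp (reblock_injective hu (hinj a (Finset.mem_filter.1 ha).2))
      ((hEm _).union (hEm _))]
    refine (measureReal_union_le _ _).trans ?_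
    rw [hflip, two_mul]
  have h3 := h1.trans h2
  rw [Finset.sum_const, Finset.card_univ, Fintype.card_fun, Fintype.card_fin, Fintype.card_fin,
    nsmul_eq_mul, Nat.cast_pow] at h3
  have h4 : (N : ℝ) ^ (K + 2 * k) ≤ ((N : ℝ) + 1) ^ (K + 2 * k) :=
    pow_le_pow_left₀ (by positivity) (by linarith) _
  have h5 : 0 ≤ fairBits.real (E true) := measureReal_nonneg
  rw [inv_le_iff_one_le_mul₀ (by positivity)]
  nlinarith [mul_le_mul_of_nonneg_right h4 h5]

end Runs

/-! ### Shielded blocks of the network -/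

section Shield

variable {k s : ℕ}

theorem pi_coin_real_singleton {N : ℕ} (ω : Fin N → Bool) :
    (Measure.pi fun _ : Fin N => coin (1 / 2)).real {ω} = (1 / 2) ^ N := by
  have h : ∀ b : Bool, (coin (1 / 2)) {b} = ENNReal.ofReal (1 / 2) := by
    intro b
    cases b
    · simp only [coin, Measure.add_apply, Measure.smul_apply, smul_eq_mul]
      norm_num
    · simp [coin]
  rw [measureReal_def, Measure.pi_singleton]
  simp only [h, Finset.prod_const, Finset.card_univ, Fintype.card_fin]
  rw [ENNReal.toReal_pow, ENNReal.toReal_ofReal (by norm_num)]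

theorem integral_pi_coin_half {N : ℕ} (g : (Fin N → Bool) → ℝ) :
    ∫ ω, g ω ∂(Measure.pi fun _ : Fin N => coin (1 / 2)) = mean g := by
  rw [integral_fintype (Integrable.of_finite)]
  simp only [pi_coin_real_singleton, smul_eq_mul, ← Finset.mul_sum, mean, Fintype.card_fin]
  rw [one_div, inv_pow, inv_mul_eq_div]

theorem mean_indicator {N : ℕ} (Q : Set (Fin N → Bool)) :
    mean (Q.indicator 1) = fairBits.real {x | (fun i : Fin N => x i) ∈ Q} := by
  have hQ : MeasurableSet Q := Q.toFinite.measurableSet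
  rw [← integral_pi_coin_half, integral_indicator_one hQ, ← Measure.infinitePi_eq_pi,
    ← infinitePi_map_comp (coin (1 / 2)) Fin.val_injective,
    map_measureReal_apply (by fun_prop) hQ]
  rfl

/-- The first of two aligned blocks of length `u` that cover block `i` of the grid with offset
`o`. -/
def alignedBlock (o u i : ℕ) : ℕ := (i * u - o) / u

theorem alignedBlock_le {o u y : ℕ} (hu : 0 < u) :
    alignedBlock o u ((y + o) / u) ≤ y / u ∧ y / u < alignedBlock o u ((y + o) / u) + 2 := by
  have h1 : (y + o) / u * u ≤ y + o := Nat.div_mul_le_self _ _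
  have h2 : y + o < (y + o) / u * u + u := Nat.lt_div_mul_add hu
  rw [alignedBlock]
  set z := (y + o) / u * u
  constructor
  · exact Nat.div_le_div_right (by omega)
  · rw [Nat.div_lt_iff_lt_mul hu, add_mul]
    have h3 := Nat.lt_div_mul_add hu (a := z - o)
    omega

/-- Passing from the aligned grid to the grid with offset `o` costs at most one block in distance.
-/
theorem alignedBlock_far {o u y₀ y R : ℕ} (hu : 0 < u)
    (h1 : alignedBlock o u ((y₀ + o) / u) ≤ y / u + R)
    (h2 : y / u < alignedBlock o u ((y₀ + o) / u) + R) :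
    (y₀ + o) / u ≤ (y + o) / u + (R + 1) ∧ (y + o) / u ≤ (y₀ + o) / u + (R + 1) := by
  have h3 : (y₀ + o) / u * u ≤ y₀ + o := Nat.div_mul_le_self _ _
  have h4 : y₀ + o < (y₀ + o) / u * u + u := Nat.lt_div_mul_add hu
  rw [alignedBlock] at h1 h2
  set i := (y₀ + o) / u
  have h5 := Nat.lt_div_mul_add hu (a := i * u - o)
  have h6 := Nat.div_mul_le_self (i * u - o) u
  have h7 := Nat.lt_div_mul_add hu (a := y)
  have h8 := Nat.div_mul_le_self y u
  have h9 := Nat.mul_le_mul_right u h1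
  have h10 := Nat.mul_le_mul_right u (Nat.succ_le_of_lt h2)
  rw [add_mul] at h9
  rw [Nat.succ_eq_add_one, add_mul, add_mul, one_mul] at h10
  constructor
  · rw [← Nat.sub_le_iff_le_add, Nat.le_div_iff_mul_le hu, Nat.sub_mul, add_mul]
    omega
  · rw [← Nat.lt_succ_iff, Nat.succ_eq_add_one, Nat.div_lt_iff_lt_mul hu, add_mul, add_mul, add_mul]
    omega

theorem extend_flip {N : ℕ} (ω : Fin N → Bool) (y : Fin N) {i : ℕ} (hi : i ≠ y) :
    extend (flip y ω) i = extend ω i := by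
  unfold extend
  split_ifs with h
  · simp only [flip]
    rw [Function.update_of_ne]
    exact fun h' => hi (congrArg Fin.val h')
  · rfl

theorem node_extend_flip (hs : 2 ≤ s) (φ : ℕ → BoolFilter k) {N : ℕ} (ω : Fin N → Bool) (y : Fin N)
    {t l : ℕ} (h : (y : ℕ) / s ^ t < l ∨ l + 2 * k < (y : ℕ) / s ^ t) :
    node s φ (extend (flip y ω)) t l = node s φ (extend ω) t l := by
  refine node_congr hs φ fun v hv => extend_flip ω y fun hy => ?_
  have hu : 0 < s ^ t := by positivity
  have h1 : v / s ^ t < 2 * k + 1 := (Nat.div_lt_iff_lt_mul hu).2 hv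
  rw [← hy, Nat.mul_add_div hu] at h
  generalize v / s ^ t = q at h h1
  omega

/-- If the layers `t, …, t + p` are majority layers and the filters below are odd, then the blocks of
`s ^ t` inputs are shielded with respect to coarse blocks that extend far to both sides. -/
theorem shielded_network (hk : 1 ≤ k) (hs : 2 ≤ s) {p : ℕ} (hp : 2 * k + 2 ≤ s ^ p) {δ : ℝ}
    (hδ : ∀ (φ : ℕ → BoolFilter k) (t : ℕ), (∀ a < t, OddFilter (φ a)) →
      δ ≤ fairBits.real {x | ∀ i < 2 * k + 2 * radius k s p, node s φ x t i = true})
    {φ : ℕ → BoolFilter k} {n t : ℕ} (hn : t + (p + 1) ≤ n) (hodd : ∀ a < t, OddFilter (φ a))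
    (hmaj : ∀ a ≤ p, φ (t + a) = majority k) (o : ℕ) (ψ : ℕ → ℕ) (y₀ : Fin (width k s n))
    (hψ : ∀ i, (y₀ + o) / s ^ t ≤ i + (2 * k + radius k s p + 3) →
      i ≤ (y₀ + o) / s ^ t + (2 * k + radius k s p + 3) → ψ i = ψ ((y₀ + o) / s ^ t)) :
    Shielded (fun ω => sgn (network k s n φ ω)) (fun y : Fin (width k s n) => (y + o) / s ^ t) ψ δ
      ((y₀ + o) / s ^ t) := by
  classical
  set R := radius k s p with hR
  set u := s ^ t with hu'
  have hu : 0 < u := by positivity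
  set i := (y₀ + o) / u with hi
  set X := alignedBlock o u i with hX
  set w := width k s (n - t) with hw
  -- Block `i` lies in the aligned blocks `X` and `X + 1`, so it affects only the nodes in `[X - 2k,
  -- X + 2)` of layer `t`. This interval has length at most `2k + 2 ≤ s ^ p`, and `Q` asks for
  -- `true` windows of length `R` on both sides of it.
  set Q : Set (Fin (width k s n) → Bool) := {ω | ∀ l < w,
    (X ≤ l + (2 * k + R) ∧ l + 2 * k < X) ∨ (X + 2 ≤ l ∧ l < X + 2 + R) →
      node s φ (extend ω) t l = true} with hQ
  have hblock : ∀ y : Fin (width k s n), (y + o) / u = i → X ≤ y / u ∧ (y : ℕ) / u < X + 2 := by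
    intro y hy
    rw [hX, ← hy]
    exact alignedBlock_le hu
  refine ⟨Q.indicator 1, fun ω => ?_, fun y hy ω => ?_, fun y hy ω => ?_, ?_⟩
  · by_cases h : ω ∈ Q <;> simp [h]
  · have key : flip y ω ∈ Q ↔ ω ∈ Q := by
      refine forall_congr' fun l => forall_congr' fun _ => forall_congr' fun hl => ?_
      rw [node_extend_flip hs φ ω y]
      rw [← hu']
      by_contra! h
      refine hy ?_
      simp only [siblings, Finset.mem_filter, Finset.mem_univ, true_and]
      -- An input that a window node depends on is near block `i`, hence in its coarse block, but
      -- not in block `i` itself.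
      have hfar := alignedBlock_far (o := o) (y₀ := y₀) (y := y) (R := 2 * k + R + 2) hu
        (by rw [← hi, ← hX]; omega) (by rw [← hi, ← hX]; omega)
      refine ⟨hψ _ hfar.1 hfar.2, fun h' => ?_⟩
      have := hblock y h'
      omega
    by_cases h : ω ∈ Q
    · rw [Set.indicator_of_mem h, Set.indicator_of_mem (key.2 h)]
      rfl
    · rw [Set.indicator_of_notMem h, Set.indicator_of_notMem (mt key.1 h)]
  · by_cases h : ω ∈ Q
    · refine congrArg (fun b => Q.indicator 1 ω * sgn b) ?_
      have hyX := hblock y hy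
      rw [network_eq_node, network_eq_node]
      -- Nodes beyond the finite network do not influence the output, so they are set to `true` to
      -- complete the right window.
      set cut : (Fin (width k s n) → Bool) → ℕ → Bool :=
        fun ω l => if l < w then node s φ (extend ω) t l else true with hcut
      obtain ⟨e, he⟩ := Nat.exists_eq_add_of_le hn
      have hcutn : ∀ ω, node s φ (extend ω) n 0 =
          node s (fun a => φ (t + (p + 1 + a)))
            (node s (fun a => φ (t + a)) (cut ω) (p + 1)) e 0 := by
        intro ω
        rw [← node_add (fun a => φ (t + a))]
        have h1 : node s φ (extend ω) n 0 =
            node s (fun a => φ (t + a)) (node s φ (extend ω) t) (p + 1 + e) 0 := by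
          rw [← node_add]
          exact congrArg (fun a => node s φ (extend ω) a 0) (he.trans (add_assoc _ _ _))
        rw [h1]
        refine node_congr_width (m := 0) _ (fun l hl => ?_) (width_pos k s 0)
        have h2 : l < w := by
          rw [hw, he]
          convert hl using 2
          omega
        simp [hcut, h2]
      rw [hcutn, hcutn]
      congr 1
      ext j
      symm
      have hag : Agree (X - 2 * k) (X + 2) R (cut ω) (cut (flip y ω)) := by
        refine ⟨fun l hl => ?_, fun l hl hl' => ?_, fun l hl hl' => ?_⟩
        · simp only [hcut]
          rw [node_extend_flip hs φ ω y (by rw [← hu']; omega)]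
        · simp only [hcut]
          split_ifs with hlw
          · exact h l hlw (Or.inl (by omega))
          · rfl
        · simp only [hcut]
          split_ifs with hlw
          · exact h l hlw (Or.inr (by omega))
          · rfl
      exact hag.node_eq hk hs hmaj (by omega) (by omega) j
    · rw [Set.indicator_of_notMem h, zero_mul, zero_mul]
  · rw [mean_indicator]
    refine (hδ φ t hodd).trans ?_
    set X₀ := X - (2 * k + R) with hX₀
    -- Removing the aligned blocks `X` and `X + 1` closes the gap: after this rearrangement both
    -- windows lie in a single run of `2k + 2R` nodes, whose probability is at least `δ`.
    set σ : ℕ → ℕ := fun i => if i + X₀ < X then i + X₀ else i + X₀ + 2 with hσ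
    have hσinj : Function.Injective σ := by
      intro i j h
      simp only [hσ] at h
      split_ifs at h <;> omega
    rw [← fairBits_real_comp (reblock_injective hu hσinj) (measurableSet_run φ t _ true)]
    refine measureReal_mono ?_ (measure_ne_top _ _)
    intro x hx l hlw hl
    have hx' : ∀ j < 2 * k + 2 * R, node s φ (fun y => x (reblock u σ y)) t j = true := hx
    have h1 : node s φ (extend fun i : Fin (width k s n) => x i) t l = node s φ x t l := by
      refine node_congr_width φ (fun j hj => ?_) hlw
      rw [Nat.sub_add_cancel (by omega)] at hj
      simp [extend, hj]
    have h2 : x = fun y => x (reblock u id y) := by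
      ext y
      rw [reblock, id, Nat.div_add_mod]
    rw [h1, h2]
    rcases hl with hl | hl
    · rw [node_reblock_congr (b := σ) (j := l - X₀) hs φ x fun v hv => ?_]
      · exact hx' _ (by omega)
      · simp only [hσ, id]
        rw [if_pos (by omega)]
        omega
    · rw [node_reblock_congr (b := σ) (j := l - X₀ - 2) hs φ x fun v hv => ?_]
      · exact hx' _ (by omega)
      · simp only [hσ, id]
        rw [if_neg (by omega)]
        omega

end Shield

/-! ### The noise stability of a network decays with the number of majority windows -/

section Decay

variable {k s : ℕ}

theorem add_div_eq_of_near {Q m r i j : ℕ} (h1 : m ≤ j % Q) (h2 : j % Q + m < Q)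
    (h3 : j ≤ i + m) (h4 : i ≤ j + m) (hr : r = j / Q) : i / Q = r := by
  have h := Nat.div_add_mod j Q
  rw [← hr] at h
  have hc : Q * (r + 1) = Q * r + Q := by ring
  refine Nat.div_eq_of_lt_le ?_ ?_
  · rw [mul_comm]
    omega
  · rw [mul_comm, hc]
    omega

/-- A residue within `m` of the boundary of its period moves into the interior when shifted by `2m`,
as the period exceeds `4m`. -/
theorem exists_shift_inner {Q m : ℕ} (hQ : 4 * m < Q) (i : ℕ) : ∃ b : Bool,
    m ≤ (i + if b then 2 * m else 0) % Q ∧ (i + if b then 2 * m else 0) % Q + m < Q := by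
  by_cases h : m ≤ i % Q ∧ i % Q + m < Q
  · exact ⟨false, by simpa using h⟩
  · refine ⟨true, ?_⟩
    have hr := Nat.mod_lt i (show 0 < Q by omega)
    simp only [if_true]
    rw [← Nat.mod_add_mod]
    rcases lt_or_ge (i % Q + 2 * m) Q with h1 | h1
    · rw [Nat.mod_eq_of_lt h1]
      omega
    · rw [Nat.mod_eq_sub_mod h1, Nat.mod_eq_of_lt (by omega)]
      omega

theorem blockStab_sgn_le_one {N : ℕ} {l : ℝ} (hl : 0 ≤ l) (hl1 : l ≤ 1)
    (f : (Fin N → Bool) → Bool) (β : Fin N → ℕ) : blockStab l (fun ω => sgn (f ω)) β ≤ 1 := by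
  have h := parseval fun ω => sgn (f ω)
  simp only [pow_two, sgn_mul_self, mean_const] at h
  rw [← h]
  refine (Finset.sum_le_sum fun S _ => ?_).trans
    (Finset.sum_le_sum_of_subset_of_nonneg (Finset.subset_univ _) fun _ _ _ => mul_self_nonneg _)
  rw [pow_two]
  exact mul_le_of_le_one_right (mul_self_nonneg _) (pow_le_one₀ hl hl1)

/-- The windows `[q j, q j + q)` of layers, for `j < J`, that consist of majority layers. -/
def majorityWindows (q J : ℕ) (φ : ℕ → BoolFilter k) : Finset ℕ :=
  (Finset.range J).filter fun j => ∀ a < q, φ (q * j + a) = majority k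

/-- Each window of `q` layers multiplies the block length by `s ^ q`. A majority window gains the
factor `κ` with one of two shifts, any other window gains nothing, and the stability that remains at
the end is at most 1. -/
theorem exists_contraction (hk : 1 ≤ k) (hs : 2 ≤ s) : ∃ q : ℕ, 0 < q ∧ ∀ l : ℝ, 0 ≤ l → l < 1 →
    ∃ κ : ℝ, 0 ≤ κ ∧ κ < 1 ∧ ∀ (n : ℕ) (φ : ℕ → BoolFilter k), (∀ a < n, OddFilter (φ a)) →
      blockStab l (fun ω => sgn (network k s n φ ω)) (fun y => (y : ℕ)) ≤
        κ ^ (majorityWindows q (n / q) φ).card := by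
  set p := 2 * k + 2 with hp
  have hps : 2 * k + 2 ≤ s ^ p := (Nat.lt_pow_self (show 1 < s by omega)).le
  set R := radius k s p with hR
  obtain ⟨δ, hδ0, hδ1, hδ⟩ := exists_le_run k (2 * k + 2 * R)
  -- `m` is the distance to the coarse boundary that shielding requires. The choice of `q` leaves
  -- room for `p + 1` majority layers and makes `s ^ q > 4m`.
  set m := 2 * k + R + 3 with hm
  set q := 4 * m + p + 1 with hq
  have hq0 : 0 < q := by omega
  have hQ : 4 * m < s ^ q := lt_trans (by omega) (Nat.lt_pow_self (show 1 < s by omega))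
  set Q := s ^ q with hQdef
  have hQ0 : 0 < Q := by omega
  refine ⟨q, hq0, fun l hl hl1 => ?_⟩
  set η := δ * (1 - l) / (2 * ((Q : ℝ) + 1)) with hη
  have hη0 : 0 < η := by
    have : 0 < 1 - l := by linarith
    positivity
  refine ⟨(1 + η)⁻¹, by positivity, inv_lt_one_of_one_lt₀ (by linarith), fun n φ hodd => ?_⟩
  set f : (Fin (width k s n) → Bool) → ℝ := fun ω => sgn (network k s n φ ω) with hf
  set ψ : Bool → ℕ → ℕ := fun b i => (i + if b then 2 * m else 0) / Q with hψ
  have hcomp : ∀ b o J, (ψ b ∘ fun y : Fin (width k s n) => (y + o) / s ^ (q * J)) =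
      fun y : Fin (width k s n) =>
        (y + (o + (if b then 2 * m else 0) * s ^ (q * J))) / s ^ (q * (J + 1)) := by
    intro b o J
    ext y
    simp only [hψ, Function.comp_apply]
    rw [← Nat.add_mul_div_right _ _ (by positivity), Nat.div_div_eq_div_mul, ← pow_add,
      Nat.mul_succ q J, add_assoc]
  have key : ∀ J, J ≤ n / q → ∃ o, blockStab l f (fun y => (y : ℕ)) ≤
      (1 + η)⁻¹ ^ (majorityWindows q J φ).card *
        blockStab l f (fun y => (y + o) / s ^ (q * J)) := by
    intro J
    induction J with
    | zero => exact fun _ => ⟨0, by simp [majorityWindows]⟩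
    | succ J ih =>
      intro hJ
      obtain ⟨o, ho⟩ := ih (by omega)
      by_cases hgood : ∀ a < q, φ (q * J + a) = majority k
      · have hcard : (majorityWindows q (J + 1) φ).card = (majorityWindows q J φ).card + 1 := by
          rw [majorityWindows, Finset.range_add_one, Finset.filter_insert, if_pos hgood,
            Finset.card_insert_of_notMem (by simp)]
          rfl
        have hqn : q * (J + 1) ≤ n := by
          rw [mul_comm]
          exact (Nat.le_div_iff_mul_le hq0).1 hJ
        have hn : q * J + (p + 1) ≤ n := by
          rw [mul_add, mul_one] at hqn
          omega
        have hb := exists_blockStab_le hl hl1.le hδ0.le hδ1 f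
          (fun y => (y + o) / s ^ (q * J)) ψ Q ?_ ?_
        · obtain ⟨b, hb⟩ := hb
          refine ⟨o + (if b then 2 * m else 0) * s ^ (q * J), ?_⟩
          rw [hcomp] at hb
          rw [hcard, pow_succ, mul_assoc]
          exact ho.trans (mul_le_mul_of_nonneg_left hb (by positivity))
        · intro b i
          refine ⟨(Finset.range Q).image fun t => i * Q + t - if b then 2 * m else 0,
            Finset.card_image_le.trans (by simp), fun j hj => ?_⟩
          refine Finset.mem_image.2 ⟨(j + if b then 2 * m else 0) % Q,
            Finset.mem_range.2 (Nat.mod_lt _ hQ0), ?_⟩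
          rw [← hj, mul_comm]
          simp only [hψ]
          rw [Nat.div_add_mod, Nat.add_sub_cancel]
        · intro y
          obtain ⟨b, hb1, hb2⟩ := exists_shift_inner hQ ((y + o) / s ^ (q * J))
          refine ⟨b, shielded_network hk hs hps (hδ s hs) hn (fun a ha => hodd a (by omega))
            (fun a ha => hgood a (by omega)) o (ψ b) y fun i hi1 hi2 => ?_⟩
          exact add_div_eq_of_near hb1 hb2 (by omega) (by omega) rfl
      · have hcard : majorityWindows q (J + 1) φ = majorityWindows q J φ := by
          rw [majorityWindows, Finset.range_add_one, Finset.filter_insert, if_neg hgood]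
          rfl
        have h := blockStab_le_comp hl hl1.le f (fun y => (y + o) / s ^ (q * J)) (ψ false)
        rw [hcomp] at h
        rw [hcard]
        exact ⟨_, ho.trans (mul_le_mul_of_nonneg_left h (by positivity))⟩
  obtain ⟨o, ho⟩ := key _ le_rfl
  exact ho.trans (mul_le_of_le_one_right (by positivity) (blockStab_sgn_le_one hl hl1.le _ _))

end Decay

/-! ### The noise covariance -/

section Noise

variable {N : ℕ}

theorem integral_coin {ε : ℝ} (h0 : 0 ≤ ε) (h1 : ε ≤ 1) :
    ∫ b, -sgn b ∂coin ε = 1 - 2 * ε := by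
  have hfin := fun (c : ℝ) (b : Bool) =>
    Measure.smul_finite (Measure.dirac b) (ENNReal.ofReal_ne_top (r := c))
  have := hfin ε true
  have := hfin (1 - ε) false
  rw [coin, integral_add_measure Integrable.of_finite Integrable.of_finite, integral_smul_measure,
    integral_smul_measure, integral_dirac, integral_dirac, ENNReal.toReal_ofReal h0,
    ENNReal.toReal_ofReal (by linarith)]
  simp [sgn]
  ring

theorem coeff_xor (f : (Fin N → Bool) → ℝ) (η : Fin N → Bool) (S : Finset (Fin N)) :
    coeff (fun ω => f fun i => xor (ω i) (η i)) S = coeff f S * ∏ i ∈ S, -sgn (η i) := by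
  have hinv : Function.Involutive fun (ω : Fin N → Bool) i => xor (ω i) (η i) := fun ω => by
    ext i
    simp
  have h := Equiv.sum_comp hinv.toPerm fun ω => f ω * chi S (fun i => xor (ω i) (η i))
  simp only [Function.Involutive.coe_toPerm, Bool.xor_assoc, Bool.xor_self, Bool.xor_false] at h
  rw [coeff, mean, h, coeff, mean, div_mul_eq_mul_div, Finset.sum_mul]
  congr 1
  refine Finset.sum_congr rfl fun ω _ => ?_
  simp only [chi, sgn_xor, Finset.prod_mul_distrib]
  ring

theorem integral_noiseLaw {ε : ℝ} (h0 : 0 ≤ ε) (h1 : ε ≤ 1)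
    (g : (Fin N → Bool) × (Fin N → Bool) → ℝ) :
    ∫ p, g p ∂noiseLaw N ε = ∫ η, mean (fun ω => g (ω, fun i => xor (ω i) (η i)))
      ∂(Measure.pi fun _ : Fin N => coin ε) := by
  have := isProbabilityMeasure_coin h0 h1
  rw [noiseLaw, integral_map (measurable_of_countable _).aemeasurable
    (measurable_of_countable _).aestronglyMeasurable, integral_prod_symm _ Integrable.of_finite]
  simp only [integral_pi_coin_half]

theorem isProbabilityMeasure_noiseLaw {ε : ℝ} (h0 : 0 ≤ ε) (h1 : ε ≤ 1) :
    IsProbabilityMeasure (noiseLaw N ε) := by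
  have := isProbabilityMeasure_coin h0 h1
  exact Measure.isProbabilityMeasure_map (measurable_of_countable _).aemeasurable

theorem mean_sgn_eq_zero {f : (Fin N → Bool) → Bool} (hf : ∀ ω, f (fun i => !ω i) = !f ω) :
    mean (fun ω => sgn (f ω)) = 0 := by
  have hinv : Function.Involutive fun (ω : Fin N → Bool) i => !ω i := fun ω => by
    ext i
    simp
  have h := Equiv.sum_comp hinv.toPerm fun ω => sgn (f ω)
  simp only [Function.Involutive.coe_toPerm, hf, sgn_not, Finset.sum_neg_distrib] at h
  rw [mean, show ∑ ω, sgn (f ω) = 0 by linarith, zero_div]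

/-- The noise multiplies the character at `S` by `|S|` independent signs of mean `1 - 2ε`. The term
at `∅` vanishes by oddness, and for blocks that are single inputs the block count is `|S|`. -/
theorem integral_noiseLaw_mul {ε : ℝ} (h0 : 0 ≤ ε) (h1 : ε ≤ 1) {f : (Fin N → Bool) → Bool}
    (hf : ∀ ω, f (fun i => !ω i) = !f ω) :
    ∫ p, sgn (f p.1) * sgn (f p.2) ∂noiseLaw N ε =
      blockStab (1 - 2 * ε) (fun ω => sgn (f ω)) (fun y => (y : ℕ)) := by
  have := isProbabilityMeasure_coin h0 h1
  rw [integral_noiseLaw h0 h1]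
  simp only [mean_mul (fun ω => sgn (f ω))]
  have hx := fun η => coeff_xor (fun ω => sgn (f ω)) η
  simp only [hx]
  rw [integral_finsetSum _ fun _ _ => Integrable.of_finite]
  have hS : ∀ S : Finset (Fin N), ∫ η, coeff (fun ω => sgn (f ω)) S * (∏ i ∈ S, -sgn (η i)) *
      coeff (fun ω => sgn (f ω)) S ∂(Measure.pi fun _ : Fin N => coin ε) =
      coeff (fun ω => sgn (f ω)) S ^ 2 * (1 - 2 * ε) ^ S.card := by
    intro S
    have hprod : ∫ η : Fin N → Bool, ∏ i ∈ S, -sgn (η i) ∂(Measure.pi fun _ : Fin N => coin ε) =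
        (1 - 2 * ε) ^ S.card := by
      have h := integral_fintype_prod_eq_prod (μ := fun _ : Fin N => coin ε)
        (fun i b => if i ∈ S then -sgn b else 1)
      simp only [Finset.prod_ite_mem, Finset.univ_inter] at h
      rw [h, ← Finset.prod_subset (Finset.subset_univ S)
        (fun i _ hi => by
          simp only [hi, if_false, integral_const, probReal_univ, smul_eq_mul, one_mul])]
      rw [Finset.prod_congr rfl fun i hi => by
        simp only [hi, if_true]
        exact integral_coin h0 h1, Finset.prod_const]
    rw [integral_mul_const, integral_const_mul, hprod]
    ring
  simp only [hS]
  rw [← Finset.add_sum_erase _ _ (Finset.mem_univ ∅), coeff_empty, mean_sgn_eq_zero hf]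
  simp only [blockStab, Finset.card_image_of_injective _ Fin.val_injective]
  ring

theorem integral_noiseLaw_fst {ε : ℝ} (h0 : 0 ≤ ε) (h1 : ε ≤ 1) {f : (Fin N → Bool) → Bool}
    (hf : ∀ ω, f (fun i => !ω i) = !f ω) : ∫ p, sgn (f p.1) ∂noiseLaw N ε = 0 := by
  rw [integral_noiseLaw h0 h1]
  simp [mean_sgn_eq_zero hf]

theorem memLp_of_finite {α : Type*} [MeasurableSpace α] [Finite α]
    [MeasurableSingletonClass α] (μ : Measure α) [IsFiniteMeasure μ] (g : α → ℝ) :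
    MemLp g 2 μ :=
  MemLp.of_discrete

theorem noiseCov_eq {ε : ℝ} (h0 : 0 ≤ ε) (h1 : ε ≤ 1) {f : (Fin N → Bool) → Bool}
    (hf : ∀ ω, f (fun i => !ω i) = !f ω) :
    noiseCov f ε = blockStab (1 - 2 * ε) (fun ω => sgn (f ω)) (fun y => (y : ℕ)) := by
  have := isProbabilityMeasure_noiseLaw (N := N) h0 h1
  rw [noiseCov, covariance_eq_sub (memLp_of_finite _ _) (memLp_of_finite _ _),
    integral_noiseLaw_fst h0 h1 hf, zero_mul, sub_zero, ← integral_noiseLaw_mul h0 h1 hf]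
  rfl

end Noise

/-! ### Ancestors -/

section Ancestors

variable {k s : ℕ}

/-- The offset accumulated over `d` layers is at most `2k (1 + s + … + s ^ (d-1)) ≤ 2k (s ^ d - 1)`,
since `s ≥ 2`. For `k ≥ 1` this is below `2k s ^ d`, which leaves `2k` candidates for an ancestor.
-/
theorem isAncestor_bounds (hs : 2 ≤ s) {m d : ℕ} {i : Fin (width k s m)}
    {j : Fin (width k s (m + d))} (h : IsAncestor k s m d i j) :
    s ^ d * i ≤ j ∧ (j : ℕ) + 2 * k ≤ s ^ d * i + 2 * k * s ^ d := by
  induction d with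
  | zero =>
    have h' : i = j := h
    subst h'
    simp
  | succ d ih =>
    obtain ⟨l, r, hl, rfl⟩ := h
    obtain ⟨h1, h2⟩ := ih hl
    have hr := r.isLt
    have h3 := Nat.mul_le_mul_left s h1
    have h4 := Nat.mul_le_mul_left s h2
    have h5 : 2 * (2 * k) ≤ s * (2 * k) := Nat.mul_le_mul_right _ hs
    simp only [child]
    rw [pow_succ']
    constructor
    · calc s * s ^ d * (i : ℕ) = s * (s ^ d * i) := by ring
        _ ≤ s * l + r := by omega
    · calc s * (l : ℕ) + r + 2 * k ≤ s * l + s * (2 * k) := by omega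
        _ = s * (l + 2 * k) := by ring
        _ ≤ _ := h4
        _ = _ := by ring

theorem ncard_isAncestor_le (hk : 1 ≤ k) (hs : 2 ≤ s) (m d : ℕ) (j : Fin (width k s (m + d))) :
    {i : Fin (width k s m) | IsAncestor k s m d i j}.ncard ≤ 2 * k := by
  have hu : 0 < s ^ d := by positivity
  have key : ∀ i : Fin (width k s m), IsAncestor k s m d i j →
      (i : ℕ) ≤ j / s ^ d ∧ (j : ℕ) / s ^ d < i + 2 * k := by
    intro i hi
    obtain ⟨h1, h2⟩ := isAncestor_bounds hs hi
    constructor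
    · rw [Nat.le_div_iff_mul_le hu, mul_comm]
      exact h1
    · rw [Nat.div_lt_iff_lt_mul hu, add_mul, mul_comm (i : ℕ)]
      omega
  have h := Set.ncard_le_ncard_of_injOn (t := (Finset.range (2 * k) : Set ℕ))
    (s := {i : Fin (width k s m) | IsAncestor k s m d i j})
    (fun i => (j : ℕ) / s ^ d - i) (fun i hi => by
      have := key i hi
      simp only [Finset.coe_range, Set.mem_Iio]
      omega) (fun i hi i' hi' hii' => by
      have h1 := key i hi
      have h2 := key i' hi'
      have hii'' : (j : ℕ) / s ^ d - i = j / s ^ d - i' := hii'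
      exact Fin.ext (by omega)) (Finset.finite_toSet _)
  rwa [Set.ncard_coe_finset, Finset.card_range] at h

end Ancestors

/-! ### Random filters -/

section Random

variable {k s : ℕ}

theorem measurable_weighted : Measurable (weighted (k := k)) := by
  refine measurable_pi_lambda _ fun x => measurable_to_bool ?_
  have h : (fun θ : Fin (2 * k + 1) → ℝ => weighted θ x) ⁻¹' {true} =
      {θ | 0 < ∑ r, θ r * sgn (x r)} := by
    ext θ
    simp [weighted]
  rw [h]
  exact measurableSet_lt measurable_const
    (Finset.measurable_sum _ fun r _ => (measurable_pi_apply r).mul_const _)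

theorem measurable_network (k s n : ℕ) :
    Measurable fun φ : ℕ → BoolFilter k => network k s n φ := by
  induction n with
  | zero => exact measurable_const
  | succ n ih =>
    refine measurable_pi_lambda _ fun x => ?_
    have h1 : Measurable fun φ : ℕ → BoolFilter k =>
        (network k s n fun t => φ (t + 1), φ 0) :=
      (ih.comp (measurable_pi_lambda _ fun t => measurable_pi_apply (t + 1))).prodMk
        (measurable_pi_apply 0)
    exact (measurable_of_countable (fun z : ((Fin (width k s n) → Bool) → Bool) × BoolFilter k =>
      z.1 (convLayer k s n z.2 x))).comp h1

/-! ### Majority windows of independent filters -/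

theorem majorityWindows_congr {q J : ℕ} {φ φ' : ℕ → BoolFilter k}
    (h : ∀ t < q * J, φ t = φ' t) : majorityWindows q J φ = majorityWindows q J φ' := by
  refine Finset.filter_congr fun j hj => forall₂_congr fun a ha => ?_
  rw [h]
  have := Nat.mul_le_mul_left q (Nat.succ_le_of_lt (Finset.mem_range.1 hj))
  rw [Nat.mul_succ] at this
  omega

theorem majorityWindows_const (q J : ℕ) :
    (majorityWindows q J fun _ => majority k).card = J := by
  simp [majorityWindows]

open Classical in
theorem pow_card_majorityWindows_succ (κ : ℝ) (q J : ℕ) (φ : ℕ → BoolFilter k) :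
    κ ^ (majorityWindows q (J + 1) φ).card = κ ^ (majorityWindows q J φ).card *
      if ∀ a < q, φ (q * J + a) = majority k then κ else 1 := by
  rw [majorityWindows, Finset.range_add_one, Finset.filter_insert]
  split_ifs with h
  · rw [Finset.card_insert_of_notMem (by simp), pow_succ]
    rfl
  · rw [mul_one]
    rfl

variable {Ω : Type*} [MeasurableSpace Ω] {P : Measure Ω}

open Classical in
theorem integral_window_le [IsProbabilityMeasure P] {X : ℕ → Ω → BoolFilter k}
    (hX : ∀ t, Measurable (X t)) (hind : iIndepFun X P) {c κ : ℝ} (hc0 : 0 ≤ c)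
    (hc : ∀ t, c ≤ P.real {w | X t w = majority k}) (hκ1 : κ ≤ 1) (q J : ℕ) :
    ∫ w, (if ∀ a < q, X (q * J + a) w = majority k then κ else 1) ∂P ≤
      1 - c ^ q * (1 - κ) := by
  set A : Set Ω := {w | ∀ a < q, X (q * J + a) w = majority k} with hA
  have hAm : MeasurableSet A := by
    simp only [hA, Set.ofPred_forall]
    exact MeasurableSet.iInter fun a => MeasurableSet.iInter fun _ =>
      hX _ (measurableSet_singleton _)
  have hinj : Function.Injective fun a : ℕ => q * J + a := fun a b h => by
    simpa using h
  have hPA : c ^ q ≤ P.real A := by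
    have h := (hind.precomp hinj).measure_inter_preimage_eq_mul (Finset.range q)
      (sets := fun _ => {majority k}) fun _ _ => measurableSet_singleton _
    have hA' : A = ⋂ a ∈ Finset.range q, X (q * J + a) ⁻¹' {majority k} := by
      ext w
      simp [hA]
    rw [measureReal_def, hA', h, ENNReal.toReal_prod]
    calc c ^ q = ∏ a ∈ Finset.range q, c := by simp
      _ ≤ _ := Finset.prod_le_prod (fun _ _ => hc0) fun a _ => hc _
  have hint : (fun w => if ∀ a < q, X (q * J + a) w = majority k then κ else 1) =
      fun w => 1 - A.indicator 1 w * (1 - κ) := by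
    ext w
    by_cases h : ∀ a < q, X (q * J + a) w = majority k
    · rw [if_pos h, Set.indicator_of_mem (show w ∈ A from h)]
      simp
    · rw [if_neg h, Set.indicator_of_notMem (show w ∉ A from h)]
      simp
  have hI : Integrable (A.indicator (1 : Ω → ℝ)) P := (integrable_const (1 : ℝ)).indicator hAm
  rw [hint, integral_sub (integrable_const _) (hI.mul_const _), integral_mul_const,
    integral_indicator_one hAm]
  simp only [integral_const, probReal_univ, smul_eq_mul, mul_one]
  have := mul_le_mul_of_nonneg_right hPA (sub_nonneg.2 hκ1)
  linarith

/-- Distinct windows use disjoint sets of independent filters, so the expectation factorises; a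
window is all majority with probability at least `c ^ q`. -/
theorem integral_pow_majorityWindows_le [IsProbabilityMeasure P] {X : ℕ → Ω → BoolFilter k}
    (hX : ∀ t, Measurable (X t)) (hind : iIndepFun X P) {c κ : ℝ} (hc0 : 0 ≤ c)
    (hc : ∀ t, c ≤ P.real {w | X t w = majority k}) (hκ0 : 0 ≤ κ) (hκ1 : κ ≤ 1) (q J : ℕ) :
    ∫ w, κ ^ (majorityWindows q J fun t => X t w).card ∂P ≤ (1 - c ^ q * (1 - κ)) ^ J := by
  classical
  induction J with
  | zero => simp [majorityWindows]
  | succ J ih =>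
    simp only [pow_card_majorityWindows_succ]
    have hdisj : Disjoint (Finset.range (q * J)) (Finset.Ico (q * J) (q * J + q)) := by
      rw [Finset.disjoint_left]
      intro t ht ht'
      have := Finset.mem_range.1 ht
      have := (Finset.mem_Ico.1 ht').1
      omega
    -- Both factors are written as functions of finitely many filters; the padding by `majority k`
    -- is never read.
    set g₁ : ((i : Finset.range (q * J)) → BoolFilter k) → ℝ := fun v =>
      κ ^ (majorityWindows q J fun t =>
        if h : t ∈ Finset.range (q * J) then v ⟨t, h⟩ else majority k).card with hg₁
    set g₂ : ((i : Finset.Ico (q * J) (q * J + q)) → BoolFilter k) → ℝ := fun v =>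
      if ∀ a < q, (if h : q * J + a ∈ Finset.Ico (q * J) (q * J + q) then v ⟨_, h⟩
        else majority k) = majority k then κ else 1 with hg₂
    have h := (hind.indepFun_finset _ _ hdisj hX).comp (measurable_of_countable g₁)
      (measurable_of_countable g₂)
    have e₁ : (g₁ ∘ fun w (i : Finset.range (q * J)) => X i w) =
        fun w => κ ^ (majorityWindows q J fun t => X t w).card := by
      ext w
      simp only [hg₁, Function.comp_apply]
      congr 2
      refine majorityWindows_congr fun t ht => ?_
      rw [dif_pos (Finset.mem_range.2 ht)]
    have e₂ : (g₂ ∘ fun w (i : Finset.Ico (q * J) (q * J + q)) => X i w) =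
        fun w => if ∀ a < q, X (q * J + a) w = majority k then κ else 1 := by
      ext w
      simp only [hg₂, Function.comp_apply]
      refine if_congr (forall₂_congr fun a ha => ?_) rfl rfl
      rw [dif_pos (Finset.mem_Ico.2 ⟨by omega, by omega⟩)]
    have m₁ : Measurable (g₁ ∘ fun w (i : Finset.range (q * J)) => X i w) :=
      (measurable_of_countable g₁).comp (measurable_pi_lambda _ fun i => hX i)
    have m₂ : Measurable (g₂ ∘ fun w (i : Finset.Ico (q * J) (q * J + q)) => X i w) :=
      (measurable_of_countable g₂).comp (measurable_pi_lambda _ fun i => hX i)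
    have hmul := h.integral_fun_mul_eq_mul_integral m₁.aestronglyMeasurable
      m₂.aestronglyMeasurable
    rw [e₁, e₂] at hmul
    rw [hmul, pow_succ]
    have hb : 0 ≤ ∫ w, (if ∀ a < q, X (q * J + a) w = majority k then κ else 1) ∂P :=
      integral_nonneg fun w => by
        simp only [Pi.zero_apply]
        split_ifs
        · exact hκ0
        · exact zero_le_one
    have ha : 0 ≤ ∫ w, κ ^ (majorityWindows q J fun t => X t w).card ∂P :=
      integral_nonneg fun w => pow_nonneg hκ0 _
    exact mul_le_mul ih (integral_window_le hX hind hc0 hc hκ1 q J) hb (ha.trans ih)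

variable {N : ℕ}

/-- Given the function, each of the two values has mean zero almost surely, so no covariance of
conditional means remains and the annealed covariance averages the quenched ones. -/
theorem annealed_covariance_eq {ν : Measure ((Fin N → Bool) → Bool)} [IsProbabilityMeasure ν]
    {ε : ℝ} (h0 : 0 ≤ ε) (h1 : ε ≤ 1) (hν : ∀ᵐ f ∂ν, ∀ ω, f (fun i => !ω i) = !f ω) :
    covariance (fun q => sgn (q.1 q.2.1)) (fun q => sgn (q.1 q.2.2)) (ν.prod (noiseLaw N ε)) =
      ∫ f, noiseCov f ε ∂ν := by
  have := isProbabilityMeasure_noiseLaw (N := N) h0 h1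
  rw [covariance_eq_sub (memLp_of_finite _ _) (memLp_of_finite _ _),
    integral_prod _ Integrable.of_finite, integral_prod _ Integrable.of_finite]
  have hfst : ∫ f, ∫ p, sgn (f p.1) ∂noiseLaw N ε ∂ν = 0 := by
    rw [integral_congr_ae (g := fun _ => 0)]
    · simp
    · filter_upwards [hν] with f hf
      exact integral_noiseLaw_fst h0 h1 hf
  rw [hfst, zero_mul, sub_zero]
  refine integral_congr_ae ?_
  filter_upwards [hν] with f hf
  rw [noiseCov_eq h0 h1 hf, ← integral_noiseLaw_mul h0 h1 hf]
  rfl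

end Random

/-! ### Noise sensitivity -/

section Main

variable {k s : ℕ}

theorem noiseCov_network_bounds (hk : 1 ≤ k) (hs : 2 ≤ s) : ∃ q : ℕ, 0 < q ∧
    ∀ ε : ℝ, 0 < ε → ε ≤ 1 / 2 → ∃ κ : ℝ, 0 ≤ κ ∧ κ < 1 ∧
      ∀ (n : ℕ) (φ : ℕ → BoolFilter k), (∀ a, OddFilter (φ a)) →
        0 ≤ noiseCov (network k s n φ) ε ∧
        noiseCov (network k s n φ) ε ≤ κ ^ (majorityWindows q (n / q) φ).card := by
  obtain ⟨q, hq, h⟩ := exists_contraction hk hs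
  refine ⟨q, hq, fun ε hε hε1 => ?_⟩
  obtain ⟨κ, hκ0, hκ1, hκ⟩ := h (1 - 2 * ε) (by linarith) (by linarith)
  refine ⟨κ, hκ0, hκ1, fun n φ hφ => ?_⟩
  rw [noiseCov_eq hε.le (by linarith) (network_not fun a _ => hφ a)]
  exact ⟨blockStab_nonneg (by linarith) _ _, hκ n φ fun a _ => hφ a⟩

theorem tendsto_pow_div {a : ℝ} (h0 : 0 ≤ a) (h1 : a < 1) {q : ℕ} (hq : 0 < q) :
    Tendsto (fun n : ℕ => a ^ (n / q)) atTop (𝓝 0) :=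
  (tendsto_pow_atTop_nhds_zero_of_lt_one h0 h1).comp (Nat.tendsto_div_const_atTop hq.ne')

theorem noiseSensitive_iteratedMajority (hk : 1 ≤ k) (hs : 2 ≤ s) :
    NoiseSensitive (width k s) (iteratedMajority k s) := by
  obtain ⟨q, hq, h⟩ := noiseCov_network_bounds hk hs
  intro ε hε hε1
  obtain ⟨κ, hκ0, hκ1, hκ⟩ := h ε hε hε1
  refine squeeze_zero (fun n => (hκ n _ fun _ => oddFilter_majority k).1) (fun n => ?_)
    (tendsto_pow_div hκ0 hκ1 hq)
  have := (hκ n _ fun _ => oddFilter_majority k).2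
  rwa [majorityWindows_const] at this

variable {Ω : Type*} [MeasurableSpace Ω] {P : Measure Ω}

theorem random_network_noise [IsProbabilityMeasure P] (hk : 1 ≤ k) (hs : 2 ≤ s)
    {θ : ℕ → Ω → (Fin (2 * k + 1) → ℝ)} (hθ : ∀ t, Measurable (θ t)) (hind : iIndepFun θ P)
    (hties : ∀ t, ∀ᵐ w ∂P, NoTies (θ t w))
    {c : ℝ} (hc0 : 0 < c) (hc : ∀ t, c ≤ P.real {w | weighted (θ t w) = majority k})
    {ε : ℝ} (hε : 0 < ε) (hε1 : ε ≤ 1 / 2) :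
    (∀ n, ∀ᵐ f ∂P.map fun w => network k s n fun t => weighted (θ t w),
      (∀ ω, f (fun i => !ω i) = !f ω) ∧ 0 ≤ noiseCov f ε) ∧
    Tendsto (fun n => ∫ f, noiseCov f ε ∂P.map fun w => network k s n fun t => weighted (θ t w))
      atTop (𝓝 0) := by
  have hX : ∀ t, Measurable fun w => weighted (θ t w) := fun t => measurable_weighted.comp (hθ t)
  have hXind : iIndepFun (fun t w => weighted (θ t w)) P :=
    hind.comp (fun _ => weighted) fun _ => measurable_weighted
  have hF : ∀ n, Measurable fun w => network k s n fun t => weighted (θ t w) := fun n =>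
    (measurable_network k s n).comp (measurable_pi_lambda _ hX)
  have hodd : ∀ᵐ w ∂P, ∀ t, OddFilter (weighted (θ t w)) := by
    rw [ae_all_iff]
    intro t
    filter_upwards [hties t] with w hw
    exact oddFilter_weighted hw
  obtain ⟨q, hq, h⟩ := noiseCov_network_bounds hk hs
  obtain ⟨κ, hκ0, hκ1, hκ⟩ := h ε hε hε1
  have hae : ∀ n, ∀ᵐ f ∂P.map fun w => network k s n fun t => weighted (θ t w),
      (∀ ω, f (fun i => !ω i) = !f ω) ∧ 0 ≤ noiseCov f ε := by
    intro n
    rw [ae_map_iff (hF n).aemeasurable (Set.toFinite _).measurableSet]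
    filter_upwards [hodd] with w hw
    exact ⟨network_not fun a _ => hw a, (hκ n _ hw).1⟩
  have hc1 : c ≤ 1 := (hc 0).trans measureReal_le_one
  have hcq0 : 0 < c ^ q := pow_pos hc0 q
  have hcq1 : c ^ q ≤ 1 := pow_le_one₀ hc0.le hc1
  refine ⟨hae, squeeze_zero (fun n => ?_) (fun n => ?_)
    (tendsto_pow_div (a := 1 - c ^ q * (1 - κ)) (by nlinarith) (by nlinarith) hq)⟩
  · refine integral_nonneg_of_ae ?_
    filter_upwards [hae n] with f hf
    exact hf.2
  · rw [integral_map (hF n).aemeasurable (measurable_of_countable _).aestronglyMeasurable]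
    refine le_trans ?_ (integral_pow_majorityWindows_le hX hXind hc0.le hc hκ0 hκ1.le q (n / q))
    refine integral_mono_of_nonneg ?_ ?_ ?_
    · filter_upwards [hodd] with w hw
      exact (hκ n _ hw).1
    · refine Integrable.of_bound (C := 1) ?_ (ae_of_all _ fun w => ?_)
      · have hm : Measurable fun w => (majorityWindows q (n / q) fun t => weighted (θ t w)).card := by
          have hm' : Measurable fun v : Fin (q * (n / q)) → BoolFilter k =>
              (majorityWindows q (n / q) fun t =>
                if h : t < q * (n / q) then v ⟨t, h⟩ else majority k).card :=
            measurable_of_countable _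
          convert! hm'.comp (measurable_pi_lambda _ fun i : Fin (q * (n / q)) => hX i) using 2 with w
          refine congrArg Finset.card (majorityWindows_congr fun t ht => ?_)
          rw [dif_pos ht]
        exact ((measurable_of_countable fun j : ℕ => κ ^ j).comp hm).aestronglyMeasurable
      · rw [Real.norm_of_nonneg (pow_nonneg hκ0 _)]
        exact pow_le_one₀ hκ0 hκ1.le
    · filter_upwards [hodd] with w hw
      exact (hκ n _ hw).2

theorem annealedNoiseSensitive_network [IsProbabilityMeasure P] (hk : 1 ≤ k) (hs : 2 ≤ s)
    {θ : ℕ → Ω → (Fin (2 * k + 1) → ℝ)} (hθ : ∀ t, Measurable (θ t)) (hind : iIndepFun θ P)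
    (hties : ∀ t, ∀ᵐ w ∂P, NoTies (θ t w))
    {c : ℝ} (hc0 : 0 < c) (hc : ∀ t, c ≤ P.real {w | weighted (θ t w) = majority k}) :
    AnnealedNoiseSensitive (width k s)
      (fun n => P.map fun w => network k s n fun t => weighted (θ t w)) := by
  intro ε hε hε1
  obtain ⟨h1, h2⟩ := random_network_noise hk hs hθ hind hties hc0 hc hε hε1
  refine h2.congr fun n => ?_
  have : IsProbabilityMeasure (P.map fun w => network k s n fun t => weighted (θ t w)) :=
    Measure.isProbabilityMeasure_map ((measurable_network k s n).comp
      (measurable_pi_lambda _ fun t => measurable_weighted.comp (hθ t))).aemeasurable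
  exact (annealed_covariance_eq hε.le (by linarith) ((h1 n).mono fun f hf => hf.1)).symm

theorem quenchedNoiseSensitive_network [IsProbabilityMeasure P] (hk : 1 ≤ k) (hs : 2 ≤ s)
    {θ : ℕ → Ω → (Fin (2 * k + 1) → ℝ)} (hθ : ∀ t, Measurable (θ t)) (hind : iIndepFun θ P)
    (hties : ∀ t, ∀ᵐ w ∂P, NoTies (θ t w))
    {c : ℝ} (hc0 : 0 < c) (hc : ∀ t, c ≤ P.real {w | weighted (θ t w) = majority k}) :
    QuenchedNoiseSensitive (width k s)
      (fun n => P.map fun w => network k s n fun t => weighted (θ t w)) := by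
  intro ε hε hε1 δ hδ
  obtain ⟨h1, h2⟩ := random_network_noise hk hs hθ hind hties hc0 hc hε hε1
  -- Markov's inequality at level `δ` needs the mean of the nonnegative covariance below `δ * δ` to
  -- make the exceptional probability at most `δ`.
  obtain ⟨n₀, hn₀⟩ := eventually_atTop.1 (h2.eventually_lt_const (show 0 < δ * δ by positivity))
  refine ⟨n₀, fun n hn => ?_⟩
  have hprob : IsProbabilityMeasure (P.map fun w => network k s n fun t => weighted (θ t w)) :=
    Measure.isProbabilityMeasure_map ((measurable_network k s n).comp
      (measurable_pi_lambda _ fun t => measurable_weighted.comp (hθ t))).aemeasurable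
  have hmarkov := mul_meas_ge_le_integral_of_nonneg ((h1 n).mono fun f hf => hf.2)
    Integrable.of_finite δ
  have hlt := hn₀ n hn
  set ν := P.map fun w => network k s n fun t => weighted (θ t w)
  have h3 : ν.real {f | δ ≤ noiseCov f ε} ≤ δ := by
    refine le_of_mul_le_mul_left ?_ hδ
    linarith
  have h4 : ν.real {f | noiseCov f ε ≤ δ}ᶜ ≤ ν.real {f | δ ≤ noiseCov f ε} :=
    measureReal_mono (fun f hf => (not_le.1 (show ¬noiseCov f ε ≤ δ from hf)).le) (measure_ne_top _ _)
  rw [probReal_compl_eq_one_sub (Set.toFinite _).measurableSet] at h4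
  linarith

end Main

end ConvMaj

theorem mainTheorem11 (k s : ℕ) (hk : 1 ≤ k) (hs : 2 ≤ s) :
    ConvMaj.NoiseSensitive (ConvMaj.width k s) (ConvMaj.iteratedMajority k s) ∧
    (∀ (m d : ℕ) (j : Fin (ConvMaj.width k s (m + d))),
      {i : Fin (ConvMaj.width k s m) | ConvMaj.IsAncestor k s m d i j}.ncard ≤ 2 * k) ∧
    (∀ (Ω : Type*) [MeasurableSpace Ω] (P : Measure Ω) [IsProbabilityMeasure P]
      (θ : ℕ → Ω → (Fin (2 * k + 1) → ℝ)),
      (∀ t, Measurable (θ t)) →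
      iIndepFun θ P →
      (∀ t, ∀ᵐ w ∂P, ConvMaj.NoTies (θ t w)) →
      (∃ c : ℝ, 0 < c ∧
        ∀ t, c ≤ P.real {w | ConvMaj.weighted (θ t w) = ConvMaj.majority k}) →
      ConvMaj.AnnealedNoiseSensitive (ConvMaj.width k s)
        (fun n => P.map fun w => ConvMaj.network k s n fun t => ConvMaj.weighted (θ t w)) ∧
      ConvMaj.QuenchedNoiseSensitive (ConvMaj.width k s)
        (fun n => P.map fun w => ConvMaj.network k s n fun t => ConvMaj.weighted (θ t w))) := by
  refine ⟨ConvMaj.noiseSensitive_iteratedMajority hk hs,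
    fun m d j => ConvMaj.ncard_isAncestor_le hk hs m d j, ?_⟩
  intro Ω _ P _ θ hθ hind hties ⟨c, hc0, hc⟩
  exact ⟨ConvMaj.annealedNoiseSensitive_network hk hs hθ hind hties hc0 hc,
    ConvMaj.quenchedNoiseSensitive_network hk hs hθ hind hties hc0 hc⟩
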